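/- Let $\eta>0$, let $L$ be a positive integer multiple of $\eta$, let $X=\eta\mathbb Z^d/L\mathbb Z^d$, and write $\int_x F_x=\eta^d\sum_{x\in X}F_x$ and $(f,g)_X=\int_x f_xg_x$. Let $\mathcal F_N$ be the $N$-boson space of symmetric functions on $X^N$ with inner product $\langle f,g\rangle=\int_{x_1,\dots,x_N}\overline{f}\,g$ ($\mathcal F_0=\mathbb C$), let $\mathcal F=\bigoplus_{N\ge 0}\mathcal F_N$ be the bosonic Fock space (Hilbert sum) with vacuum $\Omega$, let $P_N$ be the projection onto $\mathcal F_N$, and let $\mathtt a_x^\dagger,\mathtt a_x$ be the creation and annihilation operators, with $\mathtt a_x\mathtt a_y^\dagger-\mathtt a_y^\dagger\mathtt a_x=\eta^{-d}\delta_{x,y}$, and $\mathtt n_x=\mathtt a_x^\dagger\mathtt a_x$. For $a:X\to\mathbb C$ let $|a\rangle=e^{(a,\mathtt a^\dagger)_X}\Omega\in\mathcal F$ be the unnormalized coherent state. Let $E=(E_{x,y})$ be a complex Hermitian matrix on $X$, acting by $(Ef)_x=\int_y E_{x,y}f_y$, with $E>0$, let $v=(v_{x,y})$ be a real symmetric matrix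 on $X$ with $v\ge 0$, and set $$H=\int_{x,y}E_{x,y}\,\mathtt a_x^\dagger \mathtt a_y+\tfrac12\int_{x,y}v_{x,y}\,\mathtt n_x\mathtt n_y .$$ Let $\beta>0$ and $N\in\mathbb N_0$. For a linear operator $F$ on $\mathcal F_N$ let $Z_c(H,F)=\operatorname{Tr}_{\mathcal F_N}\big[e^{-\beta H}(1+F)\big]$. For an integer $n\ge 1$ set $\epsilon=\beta/n$, $\mathbb T=\{0,\dots,n\}$ (label $j$ is the time $\epsilon j$), and for $h\in\mathbb C^{\mathbb T\times X}$ let $Q(h)$ be the operator on $\mathbb C^{\mathbb T\times X}$ with blocks $$Q(h)_{j,j'}=\delta_{j,j'}\,1-\delta_{j+1,j'}\,e^{-\epsilon E}e^{i\sqrt\epsilon\,h_{j'}},$$ where $e^{i\sqrt\epsilon h_{j'}}$ is a multiplication operator, and $(\bar a,Q(h)a)=\sum_{j}(\bar a_j,(Q(h)a)_j)_X$. Let $\mathcal Da=\prod_{j\in\mathbb T}\prod_{x\in X}\eta^d\,\frac{d\bar a_{j,x}\wedge da_{j,x}}{2\pi i}$ (each factor is $\eta^d/\pi$ times Lebesgue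 measure on $\mathbb C$), and let $\mu(dh)=\prod_{j\in\mathbb T}\mu_v(dh_j)$ on $\mathbb R^{\mathbb T\times X}$, where $\mu_v$ is the centered Gaussian probability measure on $\mathbb R^X$ with covariance $v$. Put $$Z_c^{(n)}(H,F)=\int \mu(dh)\int_{\mathbb C^{\mathbb T\times X}}\mathcal Da\;e^{-(\bar a,Q(h)a)}\,\big\langle a_n\big|(1+F)P_N\big|a_0\big\rangle .$$ Then: 1. For every linear operator $F$ on $\mathcal F_N$, $\lim_{n\to\infty}Z_c^{(n)}(H,F)=Z_c(H,F)$. For every $n\ge1$ the integral over $a$ converges absolutely for every $h\in\mathbb R^{\mathbb T\times X}$, and its value is $\mu$-integrable in $h$. 2. For every $n\ge 1$ and $h\in\mathbb R^{\mathbb T\times X}$ the Hermitian part $\tfrac12(Q(h)+Q(h)^\dagger)$ is positive definite. 3. For $F=0$, $\langle b|P_N|a\rangle=\frac1{N!}(\bar b,a)_X^N$ for all $b,a:X\to\mathbb C$; in particular the matrix element in the integrand is then $\frac{1}{N!}(\bar a_n,a_0)_X^N$. 4. For every $n\ge 1$, $Q(h)$ is invertible for all $h\in\mathbb C^{\mathbb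 T\times X}$, and $C(h)=Q(h)^{-1}$ is entire analytic in $h$ on $\mathbb C^{\mathbb T\times X}$. 5. If $E$ generates a stochastic process, i.e. all matrix elements of $e^{-\tau E}$ are nonnegative real numbers for all $\tau\ge0$, then for every $n\ge1$, every $h\in\mathbb R^{\mathbb T\times X}$ and all $(j,x),(j',x')\in\mathbb T\times X$ one has $|C(h)_{(j,x),(j',x')}|\le C(0)_{(j,x),(j',x')}$. -/

import Mathlib

open MeasureTheory ProbabilityTheory Filter Topology
open scoped ComplexOrder ComplexConjugate Matrix

noncomputable section

namespace LatticeBosons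

/-- The discrete torus `ηℤ^d / Lℤ^d` with `L = M η`; the class of `n` stands for the site `η n`. -/
abbrev Torus (d M : ℕ) : Type := Fin d → ZMod M

/-- The volume of a lattice cell is positive. -/
instance cellVolume_pos (η : ℝ) [Fact (0 < η)] (d : ℕ) : Fact (0 < η ^ d) :=
  ⟨pow_pos Fact.out d⟩

/-! ### Spaces of states

In this section `X` is the finite set of sites and `w` the volume of a lattice cell, so that
`∫_x F_x = w * ∑ x, F x` and `(f, g)_X = w * ∑ x, f x * g x`. -/

/-- The bilinear form `(f, g)_X = ∫_x f_x g_x`. -/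
def bili {X : Type} [Fintype X] (w : ℝ) (f g : X → ℂ) : ℂ := (w : ℂ) * ∑ x, f x * g x

/-- The symmetric functions of `n` sites. -/
def bosonSubmodule (X : Type) (n : ℕ) : Submodule ℂ ((Fin n → X) → ℂ) where
  carrier := {f | ∀ (σ : Equiv.Perm (Fin n)) (x : Fin n → X), f (x ∘ σ) = f x}
  add_mem' hf hg σ x := congrArg₂ (· + ·) (hf σ x) (hg σ x)
  zero_mem' _ _ := rfl
  smul_mem' c _ hf σ x := congrArg (c * ·) (hf σ x)

/-- The `n`-boson space: the symmetric functions of `n` sites, with the inner product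
`⟨f, g⟩ = ∫_{x₁, …, xₙ} conj f(x) g(x)` that is defined below from the cell volume `w`. -/
def BosonSpace (X : Type) (_w : ℝ) (n : ℕ) : Type := bosonSubmodule X n

instance (X : Type) (w : ℝ) (n : ℕ) : AddCommGroup (BosonSpace X w n) :=
  inferInstanceAs (AddCommGroup (bosonSubmodule X n))

instance (X : Type) (w : ℝ) (n : ℕ) : Module ℂ (BosonSpace X w n) :=
  inferInstanceAs (Module ℂ (bosonSubmodule X n))

instance (X : Type) [Finite X] (w : ℝ) (n : ℕ) : FiniteDimensional ℂ (BosonSpace X w n) :=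
  inferInstanceAs (FiniteDimensional ℂ (bosonSubmodule X n))

/-- The inner product `⟨f, g⟩ = ∫_{x₁, …, xₙ} conj f(x) g(x)`, conjugate linear on the left. -/
abbrev bosonCore (X : Type) [Fintype X] (w : ℝ) [Fact (0 < w)] (n : ℕ) :
    InnerProductSpace.Core ℂ (BosonSpace X w n) where
  inner f g := (w : ℂ) ^ n * ∑ x : Fin n → X, conj (f.1 x) * g.1 x
  conj_inner_symm f g := by
    simp [mul_comm]
  re_inner_nonneg f := by
    have hw : 0 < w := Fact.out
    have : (w : ℂ) ^ n * ∑ x : Fin n → X, conj (f.1 x) * f.1 x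
        = ((w ^ n * ∑ x : Fin n → X, ‖f.1 x‖ ^ 2 : ℝ) : ℂ) := by
      push_cast
      congr 1
      exact Finset.sum_congr rfl fun x _ => by rw [mul_comm, Complex.mul_conj']
    rw [this]
    simp only [RCLike.re_to_complex, Complex.ofReal_re]
    positivity
  add_left f g k := by
    have (x : Fin n → X) : (f + g).1 x = f.1 x + g.1 x := rfl
    simp [this, add_mul, Finset.sum_add_distrib, mul_add]
  smul_left f g c := by
    have (x : Fin n → X) : (c • f).1 x = c * f.1 x := rfl
    simp only [this, map_mul, Finset.mul_sum]
    exact Finset.sum_congr rfl fun x _ => by ring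
  definite f hf := by
    have hw : 0 < w := Fact.out
    have h1 : (w : ℂ) ^ n * ∑ x : Fin n → X, conj (f.1 x) * f.1 x
        = ((w ^ n * ∑ x : Fin n → X, ‖f.1 x‖ ^ 2 : ℝ) : ℂ) := by
      push_cast
      congr 1
      exact Finset.sum_congr rfl fun x _ => by rw [mul_comm, Complex.mul_conj']
    rw [h1, Complex.ofReal_eq_zero, mul_eq_zero, or_iff_right (pow_pos hw n).ne',
      Finset.sum_eq_zero_iff_of_nonneg (fun x _ => by positivity)] at hf
    refine Subtype.ext (funext fun x => ?_)
    exact norm_eq_zero.1 ((pow_eq_zero_iff two_ne_zero).1 (hf x (Finset.mem_univ x)))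

instance (X : Type) [Fintype X] (w : ℝ) [Fact (0 < w)] (n : ℕ) :
    NormedAddCommGroup (BosonSpace X w n) :=
  (bosonCore X w n).toNormedAddCommGroup

instance (X : Type) [Fintype X] (w : ℝ) [Fact (0 < w)] (n : ℕ) :
    InnerProductSpace ℂ (BosonSpace X w n) :=
  InnerProductSpace.ofCore (bosonCore X w n).toCore

lemma bosonSpace_inner {X : Type} [Fintype X] (w : ℝ) [Fact (0 < w)] (n : ℕ)
    (f g : BosonSpace X w n) :
    inner ℂ f g = (w : ℂ) ^ n * ∑ x : Fin n → X, conj (f.1 x) * g.1 x :=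
  rfl

/-- The symmetrization operator `(S f)(x₁, …, xₙ) = (1/n!) ∑_π f(x_{π(1)}, …, x_{π(n)})`. -/
def symmetrize (X : Type) (w : ℝ) (n : ℕ) : ((Fin n → X) → ℂ) →ₗ[ℂ] BosonSpace X w n where
  toFun f := ⟨fun x => (n.factorial : ℂ)⁻¹ * ∑ π : Equiv.Perm (Fin n), f (x ∘ π), fun σ x => by
    exact congrArg (_ * ·) (Equiv.sum_comp (Equiv.mulLeft σ) (fun π => f (x ∘ π)))⟩
  map_add' f g := Subtype.ext (funext fun x => by
    change _ * ∑ π : Equiv.Perm (Fin n), (f (x ∘ π) + g (x ∘ π)) = _ * _ + _ * _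
    rw [Finset.sum_add_distrib, mul_add])
  map_smul' c f := Subtype.ext (funext fun x => by
    change _ * ∑ π : Equiv.Perm (Fin n), c * f (x ∘ π) = c * (_ * _)
    rw [← Finset.mul_sum, mul_left_comm])

/-- The bosonic Fock space: the Hilbert sum of the `n`-boson spaces. -/
abbrev FockSpace (X : Type) [Fintype X] (w : ℝ) [Fact (0 < w)] : Type :=
  lp (fun n => BosonSpace X w n) 2

/-- The vacuum, as the unit vector of the zero-boson space. -/
def vacuum (X : Type) (w : ℝ) : BosonSpace X w 0 := ⟨fun _ => 1, fun _ _ => rfl⟩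

/-! ### Creation and annihilation operators, Hamiltonian

On the `n`-boson spaces, with `a_x a†_y - a†_y a_x = w⁻¹ δ_{x,y}`. -/

/-- The creation operator `a†_x ψ = √(n+1) S(e_x ⊗ ψ)` with `(e_x)_y = w⁻¹ δ_{x,y}`. -/
def creation {X : Type} [DecidableEq X] (w : ℝ) (x : X) (n : ℕ) :
    BosonSpace X w n →ₗ[ℂ] BosonSpace X w (n + 1) :=
  ((Real.sqrt (n + 1) : ℝ) : ℂ) • (symmetrize X w (n + 1) ∘ₗ
    { toFun := fun ψ y => (if y 0 = x then (w : ℂ)⁻¹ else 0) * ψ.1 (Fin.tail y)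
      map_add' := fun _ _ => funext fun _ => mul_add _ _ _
      map_smul' := fun c _ => funext fun _ => mul_left_comm _ c _ })

/-- The annihilation operator `(a_x ψ)(x₁, …, xₙ) = √(n+1) ψ(x, x₁, …, xₙ)`. -/
def annihilation {X : Type} (w : ℝ) (x : X) (n : ℕ) :
    BosonSpace X w (n + 1) →ₗ[ℂ] BosonSpace X w n where
  toFun ψ := ⟨fun y => ((Real.sqrt (n + 1) : ℝ) : ℂ) * ψ.1 (Fin.cons x y), fun σ y => by
    have h : (Fin.cons x (y ∘ σ) : Fin (n + 1) → X)
        = Fin.cons x y ∘ Equiv.Perm.decomposeFin.symm (0, σ) := by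
      funext i
      refine Fin.cases ?_ (fun j => ?_) i <;> simp
    simp only [h]
    rw [ψ.2]⟩
  map_add' _ _ := Subtype.ext (funext fun _ => mul_add _ _ _)
  map_smul' c _ := Subtype.ext (funext fun _ => mul_left_comm _ c _)

/-- The operator `a†_x a_y` on the `n`-boson space (the annihilation operators kill the vacuum). -/
def hop {X : Type} [DecidableEq X] (w : ℝ) (x y : X) :
    (n : ℕ) → BosonSpace X w n →ₗ[ℂ] BosonSpace X w n
  | 0 => 0
  | n + 1 => creation w x n ∘ₗ annihilation w y n

/-- The local density operator `n_x = a†_x a_x`. -/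
def density {X : Type} [DecidableEq X] (w : ℝ) (x : X) (n : ℕ) :
    BosonSpace X w n →ₗ[ℂ] BosonSpace X w n :=
  hop w x x n

/-- The Hamiltonian `∫_{x,y} E_{x,y} a†_x a_y + (1/2) ∫_{x,y} v_{x,y} n_x n_y` on the `N`-boson
space. -/
def hamiltonian {X : Type} [Fintype X] [DecidableEq X] (w : ℝ) (E : Matrix X X ℂ)
    (v : Matrix X X ℝ) (N : ℕ) : BosonSpace X w N →ₗ[ℂ] BosonSpace X w N :=
  (w : ℂ) ^ 2 • ∑ x, ∑ y, E x y • hop w x y N +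
    (1 / 2 : ℂ) • (w : ℂ) ^ 2 • ∑ x, ∑ y, (v x y : ℂ) • (density w x N ∘ₗ density w y N)

/-- The canonical generating function `Z_c(H, F) = Tr [e^{-βH} (1 + F)]` on the `N`-boson space. -/
def canonicalZ {X : Type} [Fintype X] [DecidableEq X] (w : ℝ) [Fact (0 < w)] (β : ℝ)
    (E : Matrix X X ℂ) (v : Matrix X X ℝ) (N : ℕ)
    (F : BosonSpace X w N →ₗ[ℂ] BosonSpace X w N) : ℂ :=
  LinearMap.trace ℂ (BosonSpace X w N)
    ((NormedSpace.exp (LinearMap.toContinuousLinearMap (-(β : ℂ) • hamiltonian w E v N)) :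
      BosonSpace X w N →L[ℂ] BosonSpace X w N).toLinearMap ∘ₗ (1 + F))

/-! ### Coherent states -/

/-- `(a, a†)_X^n Ω`, where `(a, a†)_X = ∫_x a_x a†_x`. -/
def creationPow {X : Type} [Fintype X] [DecidableEq X] (w : ℝ) (a : X → ℂ) :
    (n : ℕ) → BosonSpace X w n
  | 0 => vacuum X w
  | n + 1 => ((w : ℂ) • ∑ x, a x • creation w x n) (creationPow w a n)

/-- `(a, a†)_X^n Ω` is the function `√n! a(y₁) ⋯ a(yₙ)`. -/
lemma creationPow_apply {X : Type} [Fintype X] [DecidableEq X] (w : ℝ) [Fact (0 < w)]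
    (a : X → ℂ) (n : ℕ) (y : Fin n → X) :
    (creationPow w a n).1 y = ((Real.sqrt n.factorial : ℝ) : ℂ) * ∏ i, a (y i) := by
  induction n with
  | zero => simp [creationPow, vacuum]
  | succ n ih =>
    have hw : (w : ℂ) ≠ 0 := by
      have : 0 < w := Fact.out
      exact_mod_cast this.ne'
    have key : (creationPow w a (n + 1)).1 y = ∑ x, (w : ℂ) * (a x *
        (((Real.sqrt (n + 1) : ℝ) : ℂ) * (((n + 1).factorial : ℂ)⁻¹ *
          ∑ π : Equiv.Perm (Fin (n + 1)), (if (y ∘ π) 0 = x then (w : ℂ)⁻¹ else 0) *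
            (creationPow w a n).1 (Fin.tail (y ∘ π))))) := by
      let ev : BosonSpace X w (n + 1) →ₗ[ℂ] ℂ :=
        (LinearMap.proj y : ((Fin (n + 1) → X) → ℂ) →ₗ[ℂ] ℂ) ∘ₗ (bosonSubmodule X (n + 1)).subtype
      change ev (creationPow w a (n + 1)) = _
      rw [creationPow, LinearMap.smul_apply, LinearMap.sum_apply, map_smul, map_sum, smul_eq_mul,
        Finset.mul_sum]
      exact Finset.sum_congr rfl fun x _ => rfl
    rw [key]
    have h2 (π : Equiv.Perm (Fin (n + 1))) :
        (creationPow w a n).1 (Fin.tail (y ∘ π)) * a ((y ∘ π) 0)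
          = ((Real.sqrt n.factorial : ℝ) : ℂ) * ∏ i, a (y i) := by
      rw [ih, mul_assoc, ← Equiv.prod_comp π (fun i => a (y i)), Fin.prod_univ_succ,
        mul_comm (a _)]
      rfl
    have h3 : ∑ x, ∑ π : Equiv.Perm (Fin (n + 1)),
        (w : ℂ) * (a x * ((if (y ∘ π) 0 = x then (w : ℂ)⁻¹ else 0) *
          (creationPow w a n).1 (Fin.tail (y ∘ π))))
        = ((n + 1).factorial : ℂ) * (((Real.sqrt n.factorial : ℝ) : ℂ) * ∏ i, a (y i)) := by
      rw [Finset.sum_comm]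
      have (π : Equiv.Perm (Fin (n + 1))) : ∑ x,
          (w : ℂ) * (a x * ((if (y ∘ π) 0 = x then (w : ℂ)⁻¹ else 0) *
            (creationPow w a n).1 (Fin.tail (y ∘ π))))
          = ((Real.sqrt n.factorial : ℝ) : ℂ) * ∏ i, a (y i) := by
        rw [Finset.sum_eq_single ((y ∘ π) 0) (fun x _ hx => by rw [if_neg hx.symm]; ring) (by simp),
          if_pos rfl, ← h2 π]
        field_simp
      rw [Finset.sum_congr rfl fun π _ => this π]
      simp [Fintype.card_perm]
    have h4 : ((n + 1).factorial : ℂ) ≠ 0 := by exact_mod_cast (n + 1).factorial_ne_zero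
    calc _ = ((Real.sqrt (n + 1) : ℝ) : ℂ) * (((n + 1).factorial : ℂ)⁻¹ *
          ∑ x, ∑ π : Equiv.Perm (Fin (n + 1)),
            (w : ℂ) * (a x * ((if (y ∘ π) 0 = x then (w : ℂ)⁻¹ else 0) *
              (creationPow w a n).1 (Fin.tail (y ∘ π))))) := by
          simp only [Finset.mul_sum]
          exact Finset.sum_congr rfl fun x _ => Finset.sum_congr rfl fun π _ => by ring
      _ = _ := by
          rw [h3, inv_mul_cancel_left₀ h4, ← mul_assoc, ← Complex.ofReal_mul,
            ← Real.sqrt_mul (by positivity), Nat.factorial_succ]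
          push_cast
          rfl

lemma norm_sq_creationPow {X : Type} [Fintype X] [DecidableEq X] (w : ℝ) [Fact (0 < w)]
    (a : X → ℂ) (n : ℕ) :
    ‖creationPow w a n‖ ^ 2 = n.factorial * (w * ∑ x, ‖a x‖ ^ 2) ^ n := by
  have h : inner ℂ (creationPow w a n) (creationPow w a n)
      = ((n.factorial * (w * ∑ x, ‖a x‖ ^ 2) ^ n : ℝ) : ℂ) := by
    rw [bosonSpace_inner]
    push_cast
    have h1 : (∑ x, (‖a x‖ : ℂ) ^ 2) ^ n = ∑ y : Fin n → X, ∏ i, (‖a (y i)‖ : ℂ) ^ 2 := by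
      rw [← Fin.prod_const n (∑ x, (‖a x‖ : ℂ) ^ 2), Finset.prod_univ_sum, Fintype.piFinset_univ]
    rw [mul_pow, mul_left_comm (n.factorial : ℂ), h1, Finset.mul_sum Finset.univ _
      (n.factorial : ℂ)]
    refine congrArg _ (Finset.sum_congr rfl fun y _ => ?_)
    rw [creationPow_apply, mul_comm, Complex.mul_conj', norm_mul, norm_prod, Complex.norm_real,
      Real.norm_of_nonneg (Real.sqrt_nonneg _)]
    push_cast
    rw [mul_pow, ← Complex.ofReal_pow, Real.sq_sqrt (Nat.cast_nonneg _), Finset.prod_pow]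
    push_cast
    rfl
  rw [norm_sq_eq_re_inner (𝕜 := ℂ), h]
  exact Complex.ofReal_re _

/-- The unnormalized coherent state `e^{(a, a†)_X} Ω = ∑_n (1/n!) (a, a†)_X^n Ω` in Fock space. -/
def coherent {X : Type} [Fintype X] [DecidableEq X] (w : ℝ) [Fact (0 < w)] (a : X → ℂ) :
    FockSpace X w :=
  ⟨fun n => (n.factorial : ℂ)⁻¹ • creationPow w a n, by
    refine memℓp_gen ?_
    simp only [ENNReal.toReal_ofNat, Real.rpow_ofNat]
    refine (Real.summable_pow_div_factorial (w * ∑ x, ‖a x‖ ^ 2)).congr fun n => ?_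
    change _ = ‖(n.factorial : ℂ)⁻¹ • creationPow w a n‖ ^ 2
    rw [norm_smul, mul_pow ‖_‖, norm_sq_creationPow, norm_inv, Complex.norm_natCast]
    have : (n.factorial : ℝ) ≠ 0 := by exact_mod_cast n.factorial_ne_zero
    field_simp⟩

/-- The matrix element `⟨coh b | (1 + F) P_N coh a⟩`, where `P_N` is the projection of Fock space
onto the `N`-boson space and `F` acts on the `N`-boson space. -/
def matrixElement {X : Type} [Fintype X] [DecidableEq X] (w : ℝ) [Fact (0 < w)] (N : ℕ)
    (F : BosonSpace X w N →ₗ[ℂ] BosonSpace X w N) (b a : X → ℂ) : ℂ :=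
  inner ℂ (coherent w b)
    (lp.single 2 N ((1 + F) (coherent w a N)) : FockSpace X w)

/-! ### The time-sliced integral

Time is `{0, ε, …, n ε}` with `ε = β / n`, labelled by `Fin (n + 1)`. -/

/-- `e^{-τ E}`, acting on functions on `X` by matrix-vector multiplication, where `E` is the
operator `(E f)_x = ∫_y E_{x,y} f_y`. (Its integral kernel is `w⁻¹` times this matrix.) -/
def heat {X : Type} [Fintype X] [DecidableEq X] (w τ : ℝ) (E : Matrix X X ℂ) : Matrix X X ℂ :=
  NormedSpace.exp (-((τ : ℂ) • (w : ℂ) • E))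

/-- `E` generates a stochastic process: all matrix elements of `e^{-τ E}`, `τ ≥ 0`, are
nonnegative real numbers. -/
def GeneratesStochasticProcess {X : Type} [Fintype X] [DecidableEq X] (w : ℝ)
    (E : Matrix X X ℂ) : Prop :=
  ∀ τ : ℝ, 0 ≤ τ → ∀ x y, 0 ≤ heat w τ E x y

/-- The operator `Q(h)_{j,j'} = δ_{j,j'} 1 - δ_{j+1,j'} e^{-εE} e^{i √ε h_{j'}}`, for complex
`h`. It does not depend on `h_0`. -/
def Qop {X : Type} [Fintype X] [DecidableEq X] (w β : ℝ) (E : Matrix X X ℂ) (n : ℕ)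
    (h : Fin (n + 1) → X → ℂ) : Matrix (Fin (n + 1) × X) (Fin (n + 1) × X) ℂ :=
  Matrix.of fun p q =>
    (if p = q then 1 else 0) -
      if (p.1 : ℕ) + 1 = q.1 then
        heat w (β / n) E p.2 q.2 * Complex.exp (Complex.I * (Real.sqrt (β / n) : ℝ) * h q.1 q.2)
      else 0

/-- The covariance `C(h) = Q(h)⁻¹`. -/
def Cov {X : Type} [Fintype X] [DecidableEq X] (w β : ℝ) (E : Matrix X X ℂ) (n : ℕ)
    (h : Fin (n + 1) → X → ℂ) : Matrix (Fin (n + 1) × X) (Fin (n + 1) × X) ℂ :=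
  (Qop w β E n h)⁻¹

/-- A real auxiliary field, regarded as a complex one. -/
def toComplex {X : Type} {n : ℕ} (h : Fin (n + 1) → X → ℝ) : Fin (n + 1) → X → ℂ :=
  fun j x => (h j x : ℂ)

/-- The quadratic form `(ā, Q(h) a) = ∑_j (ā_j, (Q(h) a)_j)_X`. -/
def quadForm {X : Type} [Fintype X] [DecidableEq X] (w β : ℝ) (E : Matrix X X ℂ) (n : ℕ)
    (h : Fin (n + 1) → X → ℂ) (a : Fin (n + 1) → X → ℂ) : ℂ :=
  ∑ j, bili w (fun x => conj (a j x))
    (fun x => (Qop w β E n h *ᵥ fun p => a p.1 p.2) (j, x))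

/-- The measure `𝒟a = ∏_j ∏_x w dā_{j,x} ∧ da_{j,x} / (2πi)` on `ℂ^{𝕋 × X}`; since
`dā ∧ da = 2i dx dy` for `a = x + i y`, each factor is `w / π` times Lebesgue measure. -/
def fieldMeasure (X : Type) [Fintype X] (w : ℝ) (n : ℕ) : Measure (Fin (n + 1) → X → ℂ) :=
  ENNReal.ofReal ((w / Real.pi) ^ ((n + 1) * Fintype.card X)) • volume

/-- The centered Gaussian measure on `ℝ^{𝕋 × X}` with time-local covariance `v`. -/
def auxMeasure {X : Type} [Fintype X] [DecidableEq X] (v : Matrix X X ℝ) (n : ℕ) :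
    Measure (Fin (n + 1) → X → ℝ) :=
  Measure.pi fun _ => (multivariateGaussian (0 : EuclideanSpace ℝ X) v).map WithLp.ofLp

/-- The integrand `e^{-(ā, Q(h) a)} ⟨coh a(β) | (1 + F) P_N coh a(0)⟩`. -/
def integrand {X : Type} [Fintype X] [DecidableEq X] (w : ℝ) [Fact (0 < w)] (β : ℝ)
    (E : Matrix X X ℂ) (N : ℕ) (F : BosonSpace X w N →ₗ[ℂ] BosonSpace X w N) (n : ℕ)
    (h : Fin (n + 1) → X → ℝ) (a : Fin (n + 1) → X → ℂ) : ℂ :=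
  Complex.exp (-quadForm w β E n (toComplex h) a) *
    matrixElement w N F (a (Fin.last n)) (a 0)

/-- The time-sliced canonical generating function `∫ dμ_V(h) ∫ 𝒟a e^{-(ā, Q(h) a)} ⟨…⟩`. -/
def canonicalZSliced {X : Type} [Fintype X] [DecidableEq X] (w : ℝ) [Fact (0 < w)] (β : ℝ)
    (E : Matrix X X ℂ) (v : Matrix X X ℝ) (N : ℕ)
    (F : BosonSpace X w N →ₗ[ℂ] BosonSpace X w N) (n : ℕ) : ℂ :=
  ∫ h, ∫ a, integrand w β E N F n h a ∂(fieldMeasure X w n) ∂(auxMeasure v n)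

end LatticeBosons

end

namespace LatticeBosons

/-! ### Gaussian integrals over `ℂ` -/

/-! For fixed real `h`, the field integral is an open Gaussian chain. Since `Q(h)` is block
bidiagonal, the exponent is minus the sum of the squared slices plus hopping terms between
neighbouring times, with hopping matrices `A_j = e^{-εE} e^{i√ε h_{j+1}}`. Positivity of `E` makes
`e^{-εE}` a strict contraction and the phases are unitary, so the real part of the exponent is at
most a negative multiple of the squared norm (`chainExponent_re_le`). This gives both absolute
convergence and positivity of the Hermitian part of `Q(h)`.

The matrix element is a finite sum of monomials in `conj a_n` and `a_0`. By the reproducing property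
of the Bargmann kernel, integrating out `a_0` replaces it by `A_0 a_1`, which acts on monomials as a
tensor power of `A_0`. Iterating, and applying Wick's theorem to the last slice, gives the trace of
the kernel of `1 + F` times the tensor power of `A_0 ⋯ A_{n-1}` (`integral_integrand`).

On `N`-particle functions the phases become `exp(i√ε ∑ h(y_i))`. Different times are independent,
and the Gaussian characteristic function turns each phase into the Boltzmann factor of the
interaction over time `ε`. Hence the sliced integral is exactly a trace with the `n`-th power of a
Trotter step (`integrable_and_integral_aux`). Chernoff's formula gives the limit, because the
derivative of the step at `0` restricts to `-H` on symmetric functions.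

The statements about `C(h)` need no integral: `Q(h)` is `1` minus a nilpotent time shift, so its
inverse is a finite geometric sum, which is entire in `h` and can be bounded term by term. -/

lemma integrable_one_add_norm_pow_mul_exp (K : ℕ) {δ : ℝ} (hδ : 0 < δ) :
    Integrable (fun z : ℂ => (1 + ‖z‖) ^ K * Real.exp (-δ * ‖z‖ ^ 2)) := by
  have h1 : Integrable (fun z : ℂ => Real.exp (-(δ / 2) * ‖z‖ ^ 2)) := by
    have := (GaussianFourier.integrable_cexp_neg_mul_sq_norm_add (V := ℂ) (b := ((δ / 2 : ℝ) : ℂ))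
      (by simpa using hδ) 0 0).norm
    refine this.congr (Eventually.of_forall fun z => ?_)
    simp only [Complex.norm_exp]
    congr 1
    rw [zero_mul, add_zero, ← Complex.ofReal_neg, ← Complex.ofReal_pow, ← Complex.ofReal_mul,
      Complex.ofReal_re]
  refine (h1.const_mul (K.factorial * Real.exp (1 + 1 / (2 * δ)))).mono'
    (by fun_prop) (Eventually.of_forall fun z => ?_)
  have hz : 0 ≤ ‖z‖ := norm_nonneg z
  rw [Real.norm_of_nonneg (by positivity)]
  have h2 : (1 + ‖z‖) ^ K ≤ K.factorial * Real.exp (1 + ‖z‖) := by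
    have := Real.pow_div_factorial_le_exp (x := 1 + ‖z‖) (by positivity) K
    rwa [div_le_iff₀' (by positivity)] at this
  have h3 : ‖z‖ - δ * ‖z‖ ^ 2 ≤ 1 / (2 * δ) - δ / 2 * ‖z‖ ^ 2 := by
    have : 1 / (2 * δ) - δ / 2 * ‖z‖ ^ 2 - (‖z‖ - δ * ‖z‖ ^ 2)
        = (1 - δ * ‖z‖) ^ 2 / (2 * δ) := by field_simp; ring
    have h4 : 0 ≤ (1 - δ * ‖z‖) ^ 2 / (2 * δ) := by positivity
    linarith
  calc (1 + ‖z‖) ^ K * Real.exp (-δ * ‖z‖ ^ 2)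
      ≤ K.factorial * Real.exp (1 + ‖z‖) * Real.exp (-δ * ‖z‖ ^ 2) := by gcongr
    _ = K.factorial * Real.exp (1 + (‖z‖ - δ * ‖z‖ ^ 2)) := by
        rw [mul_assoc, ← Real.exp_add]; ring_nf
    _ ≤ K.factorial * Real.exp (1 + (1 / (2 * δ) - δ / 2 * ‖z‖ ^ 2)) := by gcongr
    _ = _ := by
        rw [mul_assoc (K.factorial : ℝ), ← Real.exp_add]; ring_nf

/-- The linear exponent leaves room for `e^{w |b| |z|}`, the dominating function when the Bargmann
kernel is expanded in powers. -/
lemma integrable_moment {w : ℝ} (hw : 0 < w) (m k : ℕ) (c : ℝ) :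
    Integrable (fun z : ℂ => ‖z‖ ^ m * ‖z‖ ^ k *
      Real.exp (c * ‖z‖ - w * ‖z‖ ^ 2)) := by
  refine ((integrable_one_add_norm_pow_mul_exp (m + k) (half_pos hw)).const_mul
    (Real.exp (c ^ 2 / (2 * w)))).mono' (by fun_prop) (Eventually.of_forall fun z => ?_)
  have hz : 0 ≤ ‖z‖ := norm_nonneg z
  rw [Real.norm_of_nonneg (by positivity), ← pow_add, mul_left_comm, ← Real.exp_add]
  have h3 : c * ‖z‖ - w * ‖z‖ ^ 2 ≤ c ^ 2 / (2 * w) + -(w / 2) * ‖z‖ ^ 2 := by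
    have : c ^ 2 / (2 * w) + -(w / 2) * ‖z‖ ^ 2 - (c * ‖z‖ - w * ‖z‖ ^ 2)
        = (c - w * ‖z‖) ^ 2 / (2 * w) := by field_simp; ring
    have h4 : 0 ≤ (c - w * ‖z‖) ^ 2 / (2 * w) := by positivity
    linarith
  gcongr
  linarith

/-- On the diagonal this is a Gamma integral. Off the diagonal, a rotation preserves Lebesgue
measure but flips the sign of the integrand. -/
lemma integral_moment {w : ℝ} (hw : 0 < w) (m k : ℕ) :
    ∫ z : ℂ, conj z ^ m * z ^ k * (Real.exp (-w * ‖z‖ ^ 2) : ℂ)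
      = if m = k then (k.factorial : ℂ) / (w : ℂ) ^ k * (Real.pi / w) else 0 := by
  split_ifs with h
  · subst h
    have h1 := Complex.integral_rpow_mul_exp_neg_mul_rpow (p := 2) (q := 2 * m) (b := w)
      (by norm_num) (by have : (0 : ℝ) ≤ m := m.cast_nonneg
                        linarith) hw
    have h2 (z : ℂ) : conj z ^ m * z ^ m * (Real.exp (-w * ‖z‖ ^ 2) : ℂ)
        = ((‖z‖ ^ (2 * m : ℝ) * Real.exp (-w * ‖z‖ ^ (2 : ℝ)) : ℝ) : ℂ) := by
      rw [← mul_pow, mul_comm (conj z), Complex.mul_conj', ← pow_mul]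
      push_cast
      congr 2
      · norm_cast
      · norm_cast
    simp_rw [h2]
    rw [integral_complex_ofReal, h1, show (2 * (m : ℝ) + 2) / 2 = m + 1 by ring,
      Real.Gamma_nat_eq_factorial, show -(2 * (m : ℝ) + 2) / 2 = -((m + 1 : ℕ) : ℝ) by push_cast; ring,
      Real.rpow_neg hw.le, Real.rpow_natCast]
    push_cast
    have : (w : ℂ) ≠ 0 := by exact_mod_cast hw.ne'
    field_simp
    ring
  · set I := ∫ z : ℂ, conj z ^ m * z ^ k * (Real.exp (-w * ‖z‖ ^ 2) : ℂ) with hI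
    -- Rotation by the angle `π / (k - m)` multiplies `conj z ^ m * z ^ k` by `e^{iπ} = -1`.
    let θ : ℂ := Complex.I * (Real.pi / ((k : ℂ) - m))
    have hkm : (k : ℂ) - m ≠ 0 := sub_ne_zero.2 (by exact_mod_cast Ne.symm h)
    have hθ : conj θ = -θ := by simp [θ]
    have hu : ‖Complex.exp θ‖ = 1 := by
      have : θ = ((Real.pi / ((k : ℝ) - m) : ℝ) : ℂ) * Complex.I := by
        simp only [θ]; push_cast; ring
      rw [this, Complex.norm_exp_ofReal_mul_I]
    let u : Circle := ⟨Complex.exp θ, by simpa [Submonoid.unitSphere] using hu⟩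
    have h1 : ∫ z : ℂ, conj (rotation u z) ^ m * (rotation u z) ^ k *
        (Real.exp (-w * ‖rotation u z‖ ^ 2) : ℂ) = I := by
      have hmp := (rotation u).measurePreserving
      exact hmp.integral_comp (rotation u).toHomeomorph.measurableEmbedding
        (fun z => conj z ^ m * z ^ k * (Real.exp (-w * ‖z‖ ^ 2) : ℂ))
    have h2 (z : ℂ) : conj (rotation u z) ^ m * (rotation u z) ^ k *
        (Real.exp (-w * ‖rotation u z‖ ^ 2) : ℂ)
        = -1 * (conj z ^ m * z ^ k * (Real.exp (-w * ‖z‖ ^ 2) : ℂ)) := by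
      rw [LinearIsometryEquiv.norm_map, rotation_apply]
      have h3 : conj (Complex.exp θ) ^ m * Complex.exp θ ^ k = -1 := by
        rw [← Complex.exp_conj, hθ, ← Complex.exp_nat_mul, ← Complex.exp_nat_mul, ← Complex.exp_add,
          ← Complex.exp_pi_mul_I]
        congr 1
        simp only [θ]
        field_simp
        ring
      rw [← h3, map_mul]
      change (conj (Complex.exp θ) * conj z) ^ m * (Complex.exp θ * z) ^ k * _ = _
      ring
    simp_rw [h2] at h1
    rw [integral_const_mul] at h1
    have : -1 * I = I := h1
    linear_combination (-1 / 2 : ℂ) * this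

/-- The reproducing property of the one-dimensional Bargmann kernel on monomials. -/
lemma integral_reproducing {w : ℝ} (hw : 0 < w) (b : ℂ) (k : ℕ) :
    ∫ z : ℂ, Complex.exp (w * (conj z * b)) * z ^ k * (Real.exp (-w * ‖z‖ ^ 2) : ℂ)
      = b ^ k * (Real.pi / w) := by
  have hwc : (w : ℂ) ≠ 0 := by exact_mod_cast hw.ne'
  -- Expand the kernel in powers of `conj z` and integrate termwise; orthogonality of monomials
  -- keeps only the term `m = k`.
  have h := hasSum_integral_of_dominated_convergence (μ := (volume : Measure ℂ))
    (F := fun (m : ℕ) (z : ℂ) => (w * b) ^ m / m.factorial *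
      (conj z ^ m * z ^ k * (Real.exp (-w * ‖z‖ ^ 2) : ℂ)))
    (f := fun z => Complex.exp (w * (conj z * b)) * z ^ k * (Real.exp (-w * ‖z‖ ^ 2) : ℂ))
    (fun m z => (w * ‖b‖ * ‖z‖) ^ m / m.factorial *
      (‖z‖ ^ k * Real.exp (-w * ‖z‖ ^ 2)))
    (fun m => by fun_prop)
    (fun m => Eventually.of_forall fun z => by
      simp only [norm_mul, norm_div, norm_pow, Complex.norm_real, Real.norm_of_nonneg hw.le,
        Complex.norm_natCast, RCLike.norm_conj, Real.norm_of_nonneg (Real.exp_pos _).le]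
      apply le_of_eq
      ring)
    (Eventually.of_forall fun z => (Real.summable_pow_div_factorial _).mul_right _)
    (by
      refine (integrable_moment hw 0 k (w * ‖b‖)).congr (Eventually.of_forall fun z => ?_)
      simp only
      rw [tsum_mul_right, ← congrFun NormedSpace.exp_eq_tsum_div, ← congrFun Real.exp_eq_exp_ℝ,
        sub_eq_add_neg, Real.exp_add, ← neg_mul]
      ring)
    (Eventually.of_forall fun z => by
      have h1 := NormedSpace.expSeries_div_hasSum_exp (𝔸 := ℂ) (w * (conj z * b))
      rw [← congrFun Complex.exp_eq_exp_ℂ] at h1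
      have h2 := (h1.mul_right (z ^ k)).mul_right (Real.exp (-w * ‖z‖ ^ 2) : ℂ)
      refine (funext fun m => ?_ : (fun m : ℕ => (w * b) ^ m / m.factorial *
        (conj z ^ m * z ^ k * (Real.exp (-w * ‖z‖ ^ 2) : ℂ))) = _) ▸ h2
      simp only [mul_pow]
      ring)
  have h3 : (fun m : ℕ => ∫ z : ℂ, (w * b) ^ m / m.factorial *
      (conj z ^ m * z ^ k * (Real.exp (-w * ‖z‖ ^ 2) : ℂ)))
      = fun m => if m = k then b ^ k * (Real.pi / w) else 0 := by
    funext m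
    rw [integral_const_mul, integral_moment hw]
    split_ifs with hm
    · subst hm
      have : (m.factorial : ℂ) ≠ 0 := by exact_mod_cast m.factorial_ne_zero
      rw [mul_pow]
      field_simp
    · simp
  rw [h3] at h
  exact h.unique (hasSum_ite_eq k _)

/-! ### Gaussian integrals over `ℂ^X` -/

section Sites

variable {X : Type} [Fintype X] [DecidableEq X]

/-- The number of permutations carrying the configuration `y` to `z`. -/
def permCount {N : ℕ} (y z : Fin N → X) : ℕ :=
  Fintype.card {π : Equiv.Perm (Fin N) // y ∘ π = z}

/-- The number of particles at a site. -/
def occupation {N : ℕ} (y : Fin N → X) (x : X) : ℕ := Fintype.card {i // y i = x}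

omit [Fintype X] in
lemma occupation_comp {N : ℕ} (y : Fin N → X) (π : Equiv.Perm (Fin N)) (x : X) :
    occupation (y ∘ π) x = occupation y x :=
  Fintype.card_congr (π.subtypeEquiv fun _ => Iff.rfl)

omit [Fintype X] in
-- Fibres of `y` and `z` over each site are equinumerous; gluing bijections between them gives the
-- permutation.
lemma exists_perm_of_occupation_eq {N : ℕ} {y z : Fin N → X}
    (h : ∀ x, occupation y x = occupation z x) : ∃ π : Equiv.Perm (Fin N), y ∘ π = z := by
  have e (x : X) : {i // z i = x} ≃ {i // y i = x} := Fintype.equivOfCardEq (h x).symm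
  refine ⟨(Equiv.sigmaFiberEquiv z).symm.trans ((Equiv.sigmaCongrRight e).trans
    (Equiv.sigmaFiberEquiv y)), funext fun i => ?_⟩
  exact (e (z i) ⟨i, rfl⟩).2

/-- The permutations carrying `y` to `z` form a coset of the stabilizer of `y`, or the empty set
when the occupation numbers differ. -/
lemma permCount_eq {N : ℕ} (y z : Fin N → X) :
    permCount y z = if occupation y = occupation z then ∏ x, (occupation y x).factorial else 0 := by
  split_ifs with h
  · obtain ⟨σ, rfl⟩ := exists_perm_of_occupation_eq (congrFun h)
    rw [← show _ = ∏ x, (occupation y x).factorial from DomMulAct.stabilizer_card y]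
    refine Fintype.card_congr ((Equiv.mulRight σ⁻¹).subtypeEquiv fun π => ?_)
    simp only [Equiv.coe_mulRight, Equiv.Perm.coe_mul, ← Function.comp_assoc]
    constructor
    · intro h1
      rw [h1, Function.comp_assoc, ← Equiv.Perm.coe_mul, mul_inv_cancel]; rfl
    · intro h1
      nth_rw 2 [← h1]
      rw [Function.comp_assoc, ← Equiv.Perm.coe_mul, inv_mul_cancel]; rfl
  · rw [permCount, Fintype.card_eq_zero_iff]
    exact ⟨fun π => h (funext fun x => by rw [← π.2, occupation_comp])⟩

/-- Regrouping particles by site is what lets the integrals over `ℂ^X` factor into one-dimensional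
ones. -/
lemma prod_config_eq {R : Type*} [CommMonoid R] {N : ℕ} (a : X → R) (y : Fin N → X) :
    ∏ i, a (y i) = ∏ x, a x ^ occupation y x := by
  rw [← Finset.prod_fiberwise Finset.univ y]
  refine Finset.prod_congr rfl fun x _ => ?_
  rw [Finset.prod_congr rfl (g := fun _ => a x)
    (fun i hi => by rw [(Finset.mem_filter.1 hi).2]), Finset.prod_const, occupation,
    Fintype.card_subtype]

lemma sum_occupation {N : ℕ} (y : Fin N → X) : ∑ x, occupation y x = N := by
  simp only [occupation, Fintype.card_subtype]
  rw [← Finset.card_eq_sum_card_fiberwise (fun _ _ => Finset.mem_coe.2 (Finset.mem_univ _))]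
  simp

/-- The reproducing property of the Bargmann kernel on monomials. -/
lemma integral_reproducing_sites {w : ℝ} (hw : 0 < w) {N : ℕ} (b : X → ℂ) (y : Fin N → X) :
    ∫ a : X → ℂ, Complex.exp (w * ∑ x, conj (a x) * b x) * (∏ i, a (y i)) *
      Complex.exp (-w * ∑ x, (‖a x‖ : ℂ) ^ 2)
      = (Real.pi / w) ^ Fintype.card X * ∏ i, b (y i) := by
  have h (a : X → ℂ) : Complex.exp (w * ∑ x, conj (a x) * b x) * (∏ i, a (y i)) *
      Complex.exp (-w * ∑ x, (‖a x‖ : ℂ) ^ 2) = ∏ x, Complex.exp (w * (conj (a x) * b x)) *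
        a x ^ occupation y x * (Real.exp (-w * ‖a x‖ ^ 2) : ℂ) := by
    rw [Finset.prod_mul_distrib, Finset.prod_mul_distrib, prod_config_eq, Finset.mul_sum,
      Finset.mul_sum, Complex.exp_sum, Complex.exp_sum]
    push_cast
    rfl
  simp_rw [h]
  rw [integral_fintype_prod_volume_eq_prod (fun x (z : ℂ) => Complex.exp (w * (conj z * b x)) *
        z ^ occupation y x * (Real.exp (-w * ‖z‖ ^ 2) : ℂ))]
  simp_rw [integral_reproducing hw]
  rw [Finset.prod_mul_distrib, ← prod_config_eq, Finset.prod_const, mul_comm, Finset.card_univ]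

/-- Wick's theorem for the Gaussian measure on `ℂ^X`. -/
lemma integral_wick_sites {w : ℝ} (hw : 0 < w) {N : ℕ} (y z : Fin N → X) :
    ∫ a : X → ℂ, (∏ i, conj (a (y i))) * (∏ i, a (z i)) *
      Complex.exp (-w * ∑ x, (‖a x‖ : ℂ) ^ 2)
      = (Real.pi / w) ^ Fintype.card X * (((w : ℂ) ^ N)⁻¹ * permCount y z) := by
  have hwc : (w : ℂ) ≠ 0 := by exact_mod_cast hw.ne'
  have h (a : X → ℂ) : (∏ i, conj (a (y i))) * (∏ i, a (z i)) *
      Complex.exp (-w * ∑ x, (‖a x‖ : ℂ) ^ 2) = ∏ x, conj (a x) ^ occupation y x *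
        a x ^ occupation z x * (Real.exp (-w * ‖a x‖ ^ 2) : ℂ) := by
    rw [Finset.prod_mul_distrib, Finset.prod_mul_distrib, prod_config_eq a z,
      prod_config_eq (fun x => conj (a x)) y, Finset.mul_sum, Complex.exp_sum]
    push_cast
    rfl
  simp_rw [h]
  rw [integral_fintype_prod_volume_eq_prod (fun x (ζ : ℂ) => conj ζ ^ occupation y x *
        ζ ^ occupation z x * (Real.exp (-w * ‖ζ‖ ^ 2) : ℂ))]
  simp_rw [integral_moment hw]
  -- One site with differing occupations kills the product; otherwise the factorials give the
  -- permutation count and the powers of `w` add up to `N`.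
  rw [permCount_eq]
  split_ifs with hyz
  · rw [← hyz]
    simp only [if_true]
    rw [Finset.prod_mul_distrib, Finset.prod_div_distrib, Finset.prod_pow_eq_pow_sum,
      sum_occupation, Finset.prod_const, Finset.card_univ]
    push_cast
    ring
  · obtain ⟨x, hx⟩ := Function.ne_iff.1 hyz
    rw [Finset.prod_eq_zero (Finset.mem_univ x) (if_neg hx)]
    simp

end Sites

/-! ### Tensor powers of matrices -/

section Tensor

variable {X : Type} [Fintype X] [DecidableEq X]

/-- The `N`-th tensor power of a matrix. -/
def tensorPow (N : ℕ) (A : Matrix X X ℂ) : Matrix (Fin N → X) (Fin N → X) ℂ :=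
  Matrix.of fun y z => ∏ i, A (y i) (z i)

omit [Fintype X] [DecidableEq X] in
@[simp] lemma tensorPow_apply {N : ℕ} (A : Matrix X X ℂ) (y z : Fin N → X) :
    tensorPow N A y z = ∏ i, A (y i) (z i) := rfl

omit [DecidableEq X] in
-- Substituting `A a` into a monomial is the action of the tensor power; each Gaussian integration
-- in the chain uses this.
lemma prod_mulVec {N : ℕ} (A : Matrix X X ℂ) (a : X → ℂ) (y : Fin N → X) :
    ∏ i, (A *ᵥ a) (y i) = ∑ z, tensorPow N A y z * ∏ i, a (z i) := by
  simp only [Matrix.mulVec, dotProduct, tensorPow_apply, ← Finset.prod_mul_distrib]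
  rw [Finset.prod_univ_sum, Fintype.piFinset_univ]

omit [DecidableEq X] in
lemma tensorPow_mul {N : ℕ} (A B : Matrix X X ℂ) :
    tensorPow N (A * B) = tensorPow N A * tensorPow N B := by
  ext y z
  simp only [Matrix.mul_apply, tensorPow_apply, ← Finset.prod_mul_distrib]
  rw [Finset.prod_univ_sum, Fintype.piFinset_univ]

omit [Fintype X] in
lemma tensorPow_diagonal {N : ℕ} (d : X → ℂ) :
    tensorPow N (Matrix.diagonal d) = Matrix.diagonal fun y => ∏ i, d (y i) := by
  ext y z
  rw [tensorPow_apply]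
  by_cases h : y = z
  · subst h; simp
  · rw [Matrix.diagonal_apply_ne _ h]
    obtain ⟨i, hi⟩ := Function.ne_iff.1 h
    exact Finset.prod_eq_zero (Finset.mem_univ i) (Matrix.diagonal_apply_ne _ hi)

omit [Fintype X] in
lemma tensorPow_one {N : ℕ} : tensorPow N (1 : Matrix X X ℂ) = 1 := by
  rw [← Matrix.diagonal_one, tensorPow_diagonal]
  simp

lemma tensorPow_list_prod {N : ℕ} (l : List (Matrix X X ℂ)) :
    tensorPow N l.prod = (l.map (tensorPow N)).prod := by
  induction l with
  | nil => simp [tensorPow_one]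
  | cons A l ih => rw [List.prod_cons, tensorPow_mul, ih, List.map_cons, List.prod_cons]

end Tensor

/-! ### Chains of Gaussian integrals -/

section Chain

variable {X : Type} [Fintype X]

/-- The matrix contracts the Euclidean norm by the factor `c`. -/
def ContractsBy (c : ℝ) (A : Matrix X X ℂ) : Prop :=
  ∀ b : X → ℂ, ∑ x, ‖(A *ᵥ b) x‖ ^ 2 ≤ c ^ 2 * ∑ x, ‖b x‖ ^ 2

/-- The exponent of the Gaussian chain with hopping matrices `A`. -/
noncomputable def chainExponent (w : ℝ) {n : ℕ} (A : Fin n → Matrix X X ℂ)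
    (a : Fin (n + 1) → X → ℂ) : ℂ :=
  -w * ∑ j, ∑ x, (‖a j x‖ : ℂ) ^ 2 +
    w * ∑ j : Fin n, ∑ x, conj (a j.castSucc x) * (A j *ᵥ a j.succ) x

lemma continuous_chainExponent (w : ℝ) {n : ℕ} (A : Fin n → Matrix X X ℂ) :
    Continuous (chainExponent w A) := by
  unfold chainExponent
  simp only [Matrix.mulVec, dotProduct]
  fun_prop

/-- Young's inequality, weighted by `c` so that both slices receive the same coefficient `c / 2`. -/
lemma norm_sum_conj_mul_mulVec_le {c : ℝ} (hc : 0 < c) {A : Matrix X X ℂ} (hA : ContractsBy c A)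
    (a b : X → ℂ) :
    ‖∑ x, conj (a x) * (A *ᵥ b) x‖ ≤ c / 2 * (∑ x, ‖a x‖ ^ 2 + ∑ x, ‖b x‖ ^ 2) := by
  have h1 (x : X) : ‖conj (a x) * (A *ᵥ b) x‖
      ≤ c / 2 * ‖a x‖ ^ 2 + 1 / (2 * c) * ‖(A *ᵥ b) x‖ ^ 2 := by
    rw [norm_mul, RCLike.norm_conj]
    have : c / 2 * ‖a x‖ ^ 2 + 1 / (2 * c) * ‖(A *ᵥ b) x‖ ^ 2 - ‖a x‖ * ‖(A *ᵥ b) x‖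
        = (c * ‖a x‖ - ‖(A *ᵥ b) x‖) ^ 2 / (2 * c) := by field_simp; ring
    have h4 : 0 ≤ (c * ‖a x‖ - ‖(A *ᵥ b) x‖) ^ 2 / (2 * c) := by positivity
    linarith
  calc _ ≤ ∑ x, (c / 2 * ‖a x‖ ^ 2 + 1 / (2 * c) * ‖(A *ᵥ b) x‖ ^ 2) :=
        (norm_sum_le _ _).trans (Finset.sum_le_sum fun x _ => h1 x)
    _ = c / 2 * ∑ x, ‖a x‖ ^ 2 + 1 / (2 * c) * ∑ x, ‖(A *ᵥ b) x‖ ^ 2 := by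
        rw [Finset.sum_add_distrib, Finset.mul_sum, Finset.mul_sum]
    _ ≤ c / 2 * ∑ x, ‖a x‖ ^ 2 + 1 / (2 * c) * (c ^ 2 * ∑ x, ‖b x‖ ^ 2) := by
        gcongr
        exact hA b
    _ = _ := by field_simp

/-- Each slice takes part in at most two hopping terms, each costing `c / 2`. -/
lemma norm_chain_hopping_le {c : ℝ} (hc : 0 < c) {n : ℕ} {A : Fin n → Matrix X X ℂ}
    (hA : ∀ j, ContractsBy c (A j)) (a : Fin (n + 1) → X → ℂ) :
    ‖∑ j : Fin n, ∑ x, conj (a j.castSucc x) * (A j *ᵥ a j.succ) x‖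
      ≤ c * ∑ j, ∑ x, ‖a j x‖ ^ 2 := by
  have h0 (j : Fin (n + 1)) : 0 ≤ ∑ x, ‖a j x‖ ^ 2 := by positivity
  have h1 : ∑ j : Fin n, ∑ x, ‖a j.castSucc x‖ ^ 2 ≤ ∑ j, ∑ x, ‖a j x‖ ^ 2 := by
    rw [Fin.sum_univ_castSucc]
    linarith [h0 (Fin.last n)]
  have h2 : ∑ j : Fin n, ∑ x, ‖a j.succ x‖ ^ 2 ≤ ∑ j, ∑ x, ‖a j x‖ ^ 2 := by
    rw [Fin.sum_univ_succ]
    linarith [h0 0]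
  calc _ ≤ ∑ j : Fin n, c / 2 * (∑ x, ‖a j.castSucc x‖ ^ 2 + ∑ x, ‖a j.succ x‖ ^ 2) :=
        (norm_sum_le _ _).trans
          (Finset.sum_le_sum fun j _ => norm_sum_conj_mul_mulVec_le hc (hA j) _ _)
    _ = c / 2 * (∑ j : Fin n, ∑ x, ‖a j.castSucc x‖ ^ 2 +
          ∑ j : Fin n, ∑ x, ‖a j.succ x‖ ^ 2) := by
        rw [← Finset.mul_sum, Finset.sum_add_distrib]
    _ ≤ c / 2 * (∑ j, ∑ x, ‖a j x‖ ^ 2 + ∑ j, ∑ x, ‖a j x‖ ^ 2) := by gcongr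
    _ = _ := by ring

lemma chainExponent_re_le {w c : ℝ} (hw : 0 < w) (hc : 0 < c) {n : ℕ}
    {A : Fin n → Matrix X X ℂ} (hA : ∀ j, ContractsBy c (A j)) (a : Fin (n + 1) → X → ℂ) :
    (chainExponent w A a).re ≤ -(w * (1 - c)) * ∑ j, ∑ x, ‖a j x‖ ^ 2 := by
  have h1 := (Complex.re_le_norm _).trans (norm_chain_hopping_le hc hA a)
  have h2 : (chainExponent w A a).re = -w * ∑ j, ∑ x, ‖a j x‖ ^ 2 +
      w * (∑ j : Fin n, ∑ x, conj (a j.castSucc x) * (A j *ᵥ a j.succ) x).re := by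
    rw [chainExponent, Complex.add_re, ← Complex.re_ofReal_mul]
    congr 1
    rw [← Complex.ofReal_re (-w * ∑ j, ∑ x, ‖a j x‖ ^ 2)]
    push_cast
    rfl
  rw [h2]
  nlinarith [mul_le_mul_of_nonneg_left h1 hw.le]

/-- The polynomial weight is a product over all times and sites so that the majorant factorizes into
one-dimensional integrals. -/
lemma integrable_of_norm_le_gaussian {n K : ℕ} {δ : ℝ} (hδ : 0 < δ)
    {f : (Fin (n + 1) → X → ℂ) → ℂ} (hf : Continuous f)
    (h : ∀ a, ‖f a‖ ≤ (∏ j, ∏ x, (1 + ‖a j x‖)) ^ K *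
      Real.exp (-δ * ∑ j, ∑ x, ‖a j x‖ ^ 2)) : Integrable f := by
  have h1 : Integrable (fun a : Fin (n + 1) → X → ℂ => ∏ j, ∏ x,
      ((1 + ‖a j x‖) ^ K * Real.exp (-δ * ‖a j x‖ ^ 2))) :=
    Integrable.fintype_prod (f := fun _ (b : X → ℂ) => ∏ x,
      ((1 + ‖b x‖) ^ K * Real.exp (-δ * ‖b x‖ ^ 2))) fun _ =>
      Integrable.fintype_prod fun _ => integrable_one_add_norm_pow_mul_exp K hδ
  refine h1.mono' hf.aestronglyMeasurable (Eventually.of_forall fun a => (h a).trans (le_of_eq ?_))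
  simp only [Finset.prod_mul_distrib, Finset.prod_pow, ← Real.exp_sum, Finset.mul_sum]

/-- All factors `1 + ‖a j x‖` are at least `1`, so the full product dominates any single coordinate.
-/
lemma norm_config_prod_le {n N : ℕ} (a : Fin (n + 1) → X → ℂ) (j : Fin (n + 1))
    (y : Fin N → X) : ∏ i, ‖a j (y i)‖ ≤ (∏ j, ∏ x, (1 + ‖a j x‖)) ^ N := by
  have h1 (j : Fin (n + 1)) (x : X) : 1 ≤ 1 + ‖a j x‖ := by linarith [norm_nonneg (a j x)]
  have h2 (x : X) : ‖a j x‖ ≤ ∏ j, ∏ x, (1 + ‖a j x‖) := by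
    calc ‖a j x‖ ≤ 1 + ‖a j x‖ := by linarith
      _ ≤ ∏ x, (1 + ‖a j x‖) := by
          simpa using Finset.prod_le_prod_of_subset_of_one_le
            (Finset.subset_univ {x}) (f := fun x => 1 + ‖a j x‖)
            (fun x _ => zero_le_one.trans (h1 j x)) (fun x _ _ => h1 j x)
      _ ≤ _ := by
          simpa using Finset.prod_le_prod_of_subset_of_one_le
            (Finset.subset_univ {j}) (f := fun j => ∏ x, (1 + ‖a j x‖))
            (fun j _ => Finset.prod_nonneg fun x _ => zero_le_one.trans (h1 j x))
            (fun j _ _ => Finset.one_le_prod fun x _ => h1 j x)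
  calc _ ≤ ∏ _i : Fin N, ∏ j, ∏ x, (1 + ‖a j x‖) :=
        Finset.prod_le_prod (fun _ _ => norm_nonneg _) fun i _ => h2 (y i)
    _ = _ := by simp

/-- The integrand of the Gaussian chain with monomials at its two ends. -/
noncomputable def chainIntegrand (w : ℝ) {n N : ℕ} (A : Fin n → Matrix X X ℂ) (y z : Fin N → X)
    (a : Fin (n + 1) → X → ℂ) : ℂ :=
  Complex.exp (chainExponent w A a) *
    ((∏ i, conj (a (Fin.last n) (y i))) * ∏ i, a 0 (z i))

lemma integrable_chainIntegrand {w c : ℝ} (hw : 0 < w) (hc : 0 < c) (hc1 : c < 1) {n N : ℕ}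
    {A : Fin n → Matrix X X ℂ} (hA : ∀ j, ContractsBy c (A j)) (y z : Fin N → X) :
    Integrable (chainIntegrand w A y z) := by
  refine integrable_of_norm_le_gaussian (K := N + N) (mul_pos hw (sub_pos.2 hc1)) ?_ fun a => ?_
  · have := continuous_chainExponent w A
    unfold chainIntegrand
    fun_prop
  · rw [chainIntegrand, norm_mul, norm_mul, norm_prod, norm_prod, Complex.norm_exp, mul_comm,
      pow_add]
    simp only [RCLike.norm_conj]
    gcongr
    · exact norm_config_prod_le a _ y
    · exact norm_config_prod_le a _ z
    · exact chainExponent_re_le hw hc hA a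

/-- The earliest slice is coupled only to the next one, which permits induction on the length of the
chain. -/
lemma chainExponent_cons (w : ℝ) {n : ℕ} (A : Fin (n + 1) → Matrix X X ℂ) (b : X → ℂ)
    (a : Fin (n + 1) → X → ℂ) :
    chainExponent w A (Fin.cons b a : Fin (n + 2) → X → ℂ)
      = w * ∑ x, conj (b x) * (A 0 *ᵥ a 0) x + -w * ∑ x, (‖b x‖ : ℂ) ^ 2 +
        chainExponent w (Fin.tail A) a := by
  simp only [chainExponent]
  rw [Fin.sum_univ_succ fun j : Fin (n + 2) =>
      ∑ x, (‖(Fin.cons b a : Fin (n + 2) → X → ℂ) j x‖ : ℂ) ^ 2,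
    Fin.sum_univ_succ fun j : Fin (n + 1) =>
      ∑ x, conj ((Fin.cons b a : Fin (n + 2) → X → ℂ) j.castSucc x) *
        (A j *ᵥ (Fin.cons b a : Fin (n + 2) → X → ℂ) j.succ) x]
  simp only [Fin.cons_zero, Fin.cons_succ, Fin.castSucc_zero, ← Fin.succ_castSucc, Fin.tail]
  ring

variable [DecidableEq X]

/-- Integrating out a Gaussian chain. -/
lemma integral_chainIntegrand {w c : ℝ} (hw : 0 < w) (hc : 0 < c) (hc1 : c < 1) {N : ℕ} :
    ∀ {n : ℕ} {A : Fin n → Matrix X X ℂ} (_ : ∀ j, ContractsBy c (A j)) (y z : Fin N → X),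
      ∫ a, chainIntegrand w A y z a
        = ((Real.pi / w : ℂ) ^ Fintype.card X) ^ (n + 1) * (((w : ℂ) ^ N)⁻¹ *
          ∑ u, tensorPow N (List.ofFn A).prod z u * permCount y u)
  | 0, A, _, y, z => by
    -- A single slice has no hopping, and Wick's theorem applies directly.
    refine ((volume_preserving_funUnique (Fin 1) (X → ℂ)).symm.integral_comp' _).symm.trans ?_
    simp only [zero_add, pow_one, List.ofFn_zero, List.prod_nil, tensorPow_one]
    have h1 : ∑ u, (1 : Matrix (Fin N → X) (Fin N → X) ℂ) z u * (permCount y u : ℂ)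
        = permCount y z := by
      simp [Matrix.one_apply]
    rw [h1, ← integral_wick_sites hw]
    refine integral_congr_ae (Eventually.of_forall fun a => ?_)
    simp only [chainIntegrand, chainExponent]
    simp
    ring
  | n + 1, A, hA, y, z => by
    have hmp := (volume_preserving_piFinSuccAbove (fun _ : Fin (n + 2) => X → ℂ) 0).symm
    have hint := (hmp.integrable_comp_emb (MeasurableEquiv.measurableEmbedding _)).2
      (integrable_chainIntegrand hw hc hc1 hA y z)
    rw [← hmp.integral_comp']
    have hcons (p : (X → ℂ) × (Fin (n + 1) → X → ℂ)) :
        (MeasurableEquiv.piFinSuccAbove (fun _ : Fin (n + 2) => X → ℂ) 0).symm p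
          = (Fin.cons p.1 p.2 : Fin (n + 2) → X → ℂ) := by
      simp [MeasurableEquiv.piFinSuccAbove_symm_apply, Fin.insertNthEquiv]
    have hint' : Integrable (fun p : (X → ℂ) × (Fin (n + 1) → X → ℂ) =>
        chainIntegrand w A y z (Fin.cons p.1 p.2 : Fin (n + 2) → X → ℂ)) (volume.prod volume) :=
      hint.congr (Eventually.of_forall fun p => by
        simp only [Function.comp, hcons])
    simp only [hcons]
    refine (integral_prod_symm _ hint').trans ?_
    have h1 (a : Fin (n + 1) → X → ℂ) (b : X → ℂ) :
        chainIntegrand w A y z (Fin.cons b a : Fin (n + 2) → X → ℂ)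
          = (Complex.exp (chainExponent w (Fin.tail A) a) * ∏ i, conj (a (Fin.last n) (y i))) *
            (Complex.exp (w * ∑ x, conj (b x) * (A 0 *ᵥ a 0) x) * (∏ i, b (z i)) *
            Complex.exp (-w * ∑ x, (‖b x‖ : ℂ) ^ 2)) := by
      rw [chainIntegrand, chainExponent_cons, Complex.exp_add, Complex.exp_add,
        ← Fin.succ_last, Fin.cons_succ, Fin.cons_zero]
      ring
    -- Integrating over the earliest slice `b` replaces its monomial by the same monomial in `A 0 *ᵥ
    -- a 0`; its expansion again consists of shorter chains of the same kind.
    have h2 (a : Fin (n + 1) → X → ℂ) :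
        ∫ b, chainIntegrand w A y z (Fin.cons b a : Fin (n + 2) → X → ℂ)
          = ∑ u, (Real.pi / w : ℂ) ^ Fintype.card X * (tensorPow N (A 0) z u *
            chainIntegrand w (Fin.tail A) y u a) := by
      simp_rw [h1 a]
      rw [integral_const_mul, integral_reproducing_sites hw, prod_mulVec, Finset.mul_sum,
        Finset.mul_sum]
      refine Finset.sum_congr rfl fun u _ => ?_
      rw [chainIntegrand]
      ring
    simp only [h2]
    rw [integral_finsetSum _ fun u _ => ((integrable_chainIntegrand hw hc hc1
      (A := Fin.tail A) (fun j => hA j.succ) y u).const_mul _).const_mul _]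
    have h3 (u : Fin N → X) := integral_chainIntegrand hw hc hc1
      (A := Fin.tail A) (fun j => hA j.succ) y u
    simp only [integral_const_mul, h3]
    rw [List.ofFn_succ, List.prod_cons, tensorPow_mul]
    simp only [Matrix.mul_apply, Finset.sum_mul]
    rw [Finset.sum_comm]
    simp only [Finset.mul_sum]
    refine Finset.sum_congr rfl fun u _ => Finset.sum_congr rfl fun t _ => ?_
    change _ = _ * (_ * (_ * tensorPow N (List.ofFn (Fin.tail A)).prod u t * _))
    ring

end Chain

/-! ### The heat kernel is a strict contraction -/

section Heat

variable {X : Type} [Fintype X]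

lemma star_dotProduct_self_eq (b : X → ℂ) : star b ⬝ᵥ b = ((∑ x, ‖b x‖ ^ 2 : ℝ) : ℂ) := by
  push_cast
  exact Finset.sum_congr rfl fun x _ => by
    rw [Pi.star_apply, mul_comm]; exact Complex.mul_conj' _

variable [DecidableEq X]

lemma sum_norm_sq_unitary_mulVec {U : Matrix X X ℂ} (hU : star U * U = 1) (b : X → ℂ) :
    ∑ x, ‖(U *ᵥ b) x‖ ^ 2 = ∑ x, ‖b x‖ ^ 2 := by
  have : star (U *ᵥ b) ⬝ᵥ (U *ᵥ b) = star b ⬝ᵥ b := by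
    rw [Matrix.star_mulVec, ← Matrix.dotProduct_mulVec, Matrix.mulVec_mulVec,
      ← Matrix.star_eq_conjTranspose, hU, Matrix.one_mulVec]
  rw [star_dotProduct_self_eq, star_dotProduct_self_eq] at this
  exact_mod_cast this

/-- In an eigenbasis of `E` the heat matrix is diagonal, and the spectrum, being finite, is bounded
away from zero. -/
lemma exists_contractsBy_heat {E : Matrix X X ℂ} (hE : E.PosDef) {w τ : ℝ} (hw : 0 < w)
    (hτ : 0 < τ) : ∃ c : ℝ, 0 < c ∧ c < 1 ∧ ContractsBy c (heat w τ E) := by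
  set l := hE.isHermitian.eigenvalues
  obtain ⟨m, hm, hml⟩ : ∃ m > 0, ∀ x, m ≤ l x := by
    rcases isEmpty_or_nonempty X with h | h
    -- With no sites there is no least eigenvalue, and any positive `m` serves.
    · exact ⟨1, one_pos, fun x => h.elim x⟩
    · obtain ⟨x, hx⟩ := Finite.exists_min l
      exact ⟨l x, hE.eigenvalues_pos x, hx⟩
  refine ⟨Real.exp (-(τ * w * m)), Real.exp_pos _, ?_, fun b => ?_⟩
  · rw [Real.exp_lt_one_iff]
    have : 0 < τ * w * m := by positivity
    linarith
  · set U : Matrix X X ℂ := (hE.isHermitian.eigenvectorUnitary : Matrix X X ℂ) with hUdef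
    have hU : star U * U = 1 := Unitary.coe_star_mul_self hE.isHermitian.eigenvectorUnitary
    have hU' : U * star U = 1 := Unitary.coe_mul_star_self hE.isHermitian.eigenvectorUnitary
    have hUinv : U⁻¹ = star U := Matrix.inv_eq_right_inv hU'
    have hspec : E = U * Matrix.diagonal (fun x => (l x : ℂ)) * U⁻¹ := by
      rw [hUinv]
      have := hE.isHermitian.spectral_theorem
      rw [Unitary.conjStarAlgAut_apply] at this
      exact this
    have hheat : heat w τ E
        = U * Matrix.diagonal (fun x => (Real.exp (-(τ * w * l x)) : ℂ)) * star U := by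
      have h1 : -((τ : ℂ) • (w : ℂ) • E)
          = U * Matrix.diagonal (fun x => ((-(τ * w * l x) : ℝ) : ℂ)) * U⁻¹ := by
        have : Matrix.diagonal (fun x => ((-(τ * w * l x) : ℝ) : ℂ))
            = (-(τ * w : ℂ)) • Matrix.diagonal (fun x => (l x : ℂ)) := by
          rw [← Matrix.diagonal_smul]
          congr 1
          funext x
          simp
        rw [this, Matrix.mul_smul, Matrix.smul_mul, ← hspec, smul_smul, neg_smul]
      rw [heat, h1, Matrix.exp_conj _ _ (.of_mul_eq_one _ hU'), Matrix.exp_diagonal, hUinv]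
      congr 3
      funext x
      rw [Pi.coe_exp, ← congrFun Complex.exp_eq_exp_ℂ, Complex.ofReal_exp]
    have hsU : star (star U) * star U = 1 := by rw [star_star]; exact hU'
    rw [hheat, ← Matrix.mulVec_mulVec, ← Matrix.mulVec_mulVec, sum_norm_sq_unitary_mulVec hU,
      ← sum_norm_sq_unitary_mulVec hsU b, Finset.mul_sum]
    refine Finset.sum_le_sum fun x _ => ?_
    rw [Matrix.mulVec_diagonal, norm_mul, mul_pow, Complex.norm_real,
      Real.norm_of_nonneg (Real.exp_pos _).le]
    have h2 : τ * w * m ≤ τ * w * l x := mul_le_mul_of_nonneg_left (hml x) (by positivity)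
    gcongr

lemma ContractsBy.mul_diagonal {c : ℝ} {A : Matrix X X ℂ} (hA : ContractsBy c A) {d : X → ℂ}
    (hd : ∀ x, ‖d x‖ = 1) : ContractsBy c (A * Matrix.diagonal d) := fun b => by
  rw [← Matrix.mulVec_mulVec]
  refine (hA _).trans_eq ?_
  simp [Matrix.mulVec_diagonal, hd]

end Heat

/-! ### The quadratic form -/

section Quad

variable {X : Type} [Fintype X] [DecidableEq X]

/-- The matrix `e^{-εE} e^{i √ε h_{j+1}}` leading from the time `j + 1` to the time `j`. -/
noncomputable def hopping (w β : ℝ) (E : Matrix X X ℂ) (n : ℕ) (h : Fin (n + 1) → X → ℂ)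
    (j : Fin n) : Matrix X X ℂ :=
  heat w (β / n) E * Matrix.diagonal fun x =>
    Complex.exp (Complex.I * (Real.sqrt (β / n) : ℝ) * h j.succ x)

lemma Qop_mulVec_castSucc (w β : ℝ) (E : Matrix X X ℂ) (n : ℕ) (h : Fin (n + 1) → X → ℂ)
    (a : Fin (n + 1) → X → ℂ) (j : Fin n) (x : X) :
    (Qop w β E n h *ᵥ fun p => a p.1 p.2) (j.castSucc, x)
      = a j.castSucc x - (hopping w β E n h j *ᵥ a j.succ) x := by
  simp only [Matrix.mulVec, dotProduct, Qop, Matrix.of_apply, sub_mul, Finset.sum_sub_distrib,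
    ite_mul, one_mul, zero_mul, Finset.sum_ite_eq, Finset.mem_univ, if_true]
  congr 1
  rw [Fintype.sum_prod_type, Finset.sum_eq_single j.succ]
  · simp [hopping, Matrix.mul_diagonal]
  · intro k _ hk
    refine Finset.sum_eq_zero fun y _ => if_neg fun h1 => hk (Fin.ext ?_)
    simpa using h1.symm
  · simp

lemma Qop_mulVec_last (w β : ℝ) (E : Matrix X X ℂ) (n : ℕ) (h : Fin (n + 1) → X → ℂ)
    (a : Fin (n + 1) → X → ℂ) (x : X) :
    (Qop w β E n h *ᵥ fun p => a p.1 p.2) (Fin.last n, x) = a (Fin.last n) x := by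
  simp only [Matrix.mulVec, dotProduct, Qop, Matrix.of_apply, sub_mul, Finset.sum_sub_distrib,
    ite_mul, one_mul, zero_mul, Finset.sum_ite_eq, Finset.mem_univ, if_true]
  rw [Finset.sum_eq_zero, sub_zero]
  intro q _
  exact if_neg fun h1 => by
    have := q.1.2
    simp only [Fin.val_last] at h1
    omega

/-- Row `j < n` of `Q(h)` couples only to time `j + 1`, and the last row is the identity: the chain
is open and only the matrix element links its ends. -/
lemma neg_quadForm (w β : ℝ) (E : Matrix X X ℂ) (n : ℕ) (h : Fin (n + 1) → X → ℂ)
    (a : Fin (n + 1) → X → ℂ) :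
    -quadForm w β E n h a = chainExponent w (hopping w β E n h) a := by
  have h1 (z : ℂ) : conj z * z = (‖z‖ : ℂ) ^ 2 := by rw [mul_comm, Complex.mul_conj']
  simp only [quadForm, bili, chainExponent]
  rw [Fin.sum_univ_castSucc, Fin.sum_univ_castSucc (fun j => ∑ x, (‖a j x‖ : ℂ) ^ 2)]
  simp only [Qop_mulVec_castSucc, Qop_mulVec_last, mul_sub, Finset.sum_sub_distrib, h1,
    ← Finset.mul_sum]
  ring

lemma contractsBy_hopping {w β c : ℝ} {E : Matrix X X ℂ} {n : ℕ}
    (hc : ContractsBy c (heat w (β / n) E)) (h : Fin (n + 1) → X → ℝ) (j : Fin n) :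
    ContractsBy c (hopping w β E n (toComplex h) j) :=
  hc.mul_diagonal fun x => by
    rw [toComplex, show Complex.I * (Real.sqrt (β / n) : ℝ) * (h j.succ x : ℂ)
      = ((Real.sqrt (β / n) * h j.succ x : ℝ) : ℂ) * Complex.I by push_cast; ring,
      Complex.norm_exp_ofReal_mul_I]

/-- Up to the factor `w`, the form of the Hermitian part is minus the real part of the chain
exponent, so the bound giving integrability also gives positivity. -/
lemma posDef_hermitianPart_Qop {E : Matrix X X ℂ} (hE : E.PosDef) {w β : ℝ} (hw : 0 < w)
    (hβ : 0 < β) {n : ℕ} (hn : 1 ≤ n) (h : Fin (n + 1) → X → ℝ) :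
    ((1 / 2 : ℂ) • (Qop w β E n (toComplex h) + (Qop w β E n (toComplex h))ᴴ)).PosDef := by
  have hn' : (0 : ℝ) < n := by exact_mod_cast hn
  obtain ⟨c, hc, hc1, hcontr⟩ := exists_contractsBy_heat hE hw (div_pos hβ hn')
  set Q := Qop w β E n (toComplex h) with hQ
  refine .of_dotProduct_mulVec_pos ?_ fun v hv => ?_
  · rw [Matrix.IsHermitian, Matrix.conjTranspose_smul, Matrix.conjTranspose_add,
      Matrix.conjTranspose_conjTranspose, add_comm Qᴴ]
    simp
  · have h1 : star v ⬝ᵥ (Qᴴ *ᵥ v) = conj (star v ⬝ᵥ (Q *ᵥ v)) := by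
      rw [Matrix.dotProduct_mulVec, ← Matrix.star_mulVec, starRingEnd_apply, Matrix.star_dotProduct]
    have h2 : star v ⬝ᵥ (((1 / 2 : ℂ) • (Q + Qᴴ)) *ᵥ v) = ((star v ⬝ᵥ (Q *ᵥ v)).re : ℂ) := by
      rw [Matrix.smul_mulVec, Matrix.add_mulVec, dotProduct_smul, dotProduct_add, h1,
        Complex.add_conj, smul_eq_mul]
      push_cast
      ring
    rw [h2, Complex.zero_lt_real]
    set a : Fin (n + 1) → X → ℂ := fun j x => v (j, x) with ha
    have h3 : quadForm w β E n (toComplex h) a = (w : ℂ) * (star v ⬝ᵥ (Q *ᵥ v)) := by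
      simp only [quadForm, bili, ← Finset.mul_sum]
      congr 1
      rw [dotProduct, Fintype.sum_prod_type]
      rfl
    have h4 := chainExponent_re_le hw hc (contractsBy_hopping hcontr h) a
    rw [← neg_quadForm, h3, Complex.neg_re, Complex.re_ofReal_mul] at h4
    have h5 : 0 < ∑ j, ∑ x, ‖a j x‖ ^ 2 := by
      obtain ⟨p, hp⟩ := Function.ne_iff.1 hv
      refine Finset.sum_pos' (fun j _ => by positivity) ⟨p.1, Finset.mem_univ _, ?_⟩
      refine Finset.sum_pos' (fun j _ => by positivity) ⟨p.2, Finset.mem_univ _, ?_⟩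
      have : 0 < ‖a p.1 p.2‖ := norm_pos_iff.2 hp
      positivity
    have h6 : 0 < (1 - c) * ∑ j, ∑ x, ‖a j x‖ ^ 2 := mul_pos (by linarith) h5
    have h7 : w * ((1 - c) * ∑ j, ∑ x, ‖a j x‖ ^ 2) ≤ w * (star v ⬝ᵥ (Q *ᵥ v)).re := by linarith
    exact h6.trans_le (le_of_mul_le_mul_left h7 hw)

end Quad

/-! ### The covariance -/

section Covariance

variable {X : Type} [Fintype X] [DecidableEq X]

/-- The time-shifting part of `Q(h)`. -/
noncomputable def shiftPart (w β : ℝ) (E : Matrix X X ℂ) (n : ℕ) (h : Fin (n + 1) → X → ℂ) :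
    Matrix (Fin (n + 1) × X) (Fin (n + 1) × X) ℂ :=
  Matrix.of fun p q => if (p.1 : ℕ) + 1 = q.1 then
    heat w (β / n) E p.2 q.2 * Complex.exp (Complex.I * (Real.sqrt (β / n) : ℝ) * h q.1 q.2)
    else 0

lemma Qop_eq_one_sub (w β : ℝ) (E : Matrix X X ℂ) (n : ℕ) (h : Fin (n + 1) → X → ℂ) :
    Qop w β E n h = 1 - shiftPart w β E n h := by
  ext p q
  simp [Qop, shiftPart, Matrix.one_apply]

/-- The `k`-th power advances the time label by exactly `k`; hence nilpotency once `k` exceeds the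
last label `n`. -/
lemma shiftPart_pow_apply_eq_zero (w β : ℝ) (E : Matrix X X ℂ) (n : ℕ) (h : Fin (n + 1) → X → ℂ)
    (k : ℕ) : ∀ p q, (p.1 : ℕ) + k ≠ q.1 → (shiftPart w β E n h ^ k) p q = 0 := by
  induction k with
  | zero =>
    intro p q hpq
    rw [pow_zero, Matrix.one_apply_ne]
    rintro rfl
    exact hpq rfl
  | succ k ih =>
    intro p q hpq
    rw [pow_succ, Matrix.mul_apply]
    refine Finset.sum_eq_zero fun r _ => ?_
    by_cases h1 : (p.1 : ℕ) + k = r.1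
    · have h2 : ¬ ((r.1 : ℕ) + 1 = q.1) := by omega
      rw [shiftPart, Matrix.of_apply, if_neg h2, mul_zero]
    · rw [ih p r h1, zero_mul]

lemma shiftPart_pow_eq_zero (w β : ℝ) (E : Matrix X X ℂ) (n : ℕ) (h : Fin (n + 1) → X → ℂ) :
    shiftPart w β E n h ^ (n + 1) = 0 := by
  ext p q
  refine shiftPart_pow_apply_eq_zero w β E n h _ p q ?_
  have := q.1.2
  omega

lemma Qop_mul_geom_sum (w β : ℝ) (E : Matrix X X ℂ) (n : ℕ) (h : Fin (n + 1) → X → ℂ) :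
    Qop w β E n h * ∑ k ∈ Finset.range (n + 1), shiftPart w β E n h ^ k = 1 := by
  rw [Qop_eq_one_sub, mul_neg_geom_sum, shiftPart_pow_eq_zero, sub_zero]

lemma isUnit_Qop (w β : ℝ) (E : Matrix X X ℂ) (n : ℕ) (h : Fin (n + 1) → X → ℂ) :
    IsUnit (Qop w β E n h) :=
  .of_mul_eq_one _ (Qop_mul_geom_sum w β E n h)

lemma Cov_eq_geom_sum (w β : ℝ) (E : Matrix X X ℂ) (n : ℕ) (h : Fin (n + 1) → X → ℂ) :
    Cov w β E n h = ∑ k ∈ Finset.range (n + 1), shiftPart w β E n h ^ k :=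
  Matrix.inv_eq_right_inv (Qop_mul_geom_sum w β E n h)

/-- Entries of powers are finite sums of products of exponentials of coordinates of `h`. -/
lemma analyticOnNhd_shiftPart_pow (w β : ℝ) (E : Matrix X X ℂ) (n k : ℕ) :
    ∀ p q, AnalyticOnNhd ℂ (fun h : Fin (n + 1) → X → ℂ => (shiftPart w β E n h ^ k) p q)
      Set.univ := by
  induction k with
  | zero => intro p q; simp only [pow_zero]; exact analyticOnNhd_const
  | succ k ih =>
    intro p q
    simp only [pow_succ, Matrix.mul_apply]
    refine Finset.analyticOnNhd_fun_sum _ fun r _ => (ih p r).mul ?_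
    simp only [shiftPart, Matrix.of_apply]
    split_ifs
    · refine analyticOnNhd_const.mul (AnalyticOnNhd.cexp (analyticOnNhd_const.mul ?_))
      exact ((ContinuousLinearMap.proj (R := ℂ) (φ := fun _ : X => ℂ) q.2).comp
        (ContinuousLinearMap.proj (R := ℂ) (φ := fun _ : Fin (n + 1) => X → ℂ)
          q.1)).analyticOnNhd _
    · exact analyticOnNhd_const

lemma analyticOnNhd_Cov (w β : ℝ) (E : Matrix X X ℂ) (n : ℕ) (p q : Fin (n + 1) × X) :
    AnalyticOnNhd ℂ (fun h : Fin (n + 1) → X → ℂ => Cov w β E n h p q) Set.univ := by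
  simp only [Cov_eq_geom_sum, Matrix.sum_apply]
  exact Finset.analyticOnNhd_fun_sum _ fun k _ => analyticOnNhd_shiftPart_pow w β E n k p q

/-- In the sum over paths, real `h` contributes only phases, while at `h = 0` every term is a
product of nonnegative numbers. The order is that of `ℂ`, so the right side is also asserted to be
real. -/
lemma norm_shiftPart_pow_le {w β : ℝ} (hβ : 0 < β) {E : Matrix X X ℂ}
    (hE : GeneratesStochasticProcess w E) {n : ℕ} (h : Fin (n + 1) → X → ℝ) (k : ℕ) :
    ∀ p q, ((‖(shiftPart w β E n (toComplex h) ^ k) p q‖ : ℝ) : ℂ)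
      ≤ (shiftPart w β E n 0 ^ k) p q := by
  induction k with
  | zero =>
    intro p q
    simp only [pow_zero, Matrix.one_apply]
    split_ifs <;> simp
  | succ k ih =>
    intro p q
    simp only [pow_succ, Matrix.mul_apply]
    have h1 (r) : ((‖shiftPart w β E n (toComplex h) r q‖ : ℝ) : ℂ)
        ≤ shiftPart w β E n 0 r q := by
      simp only [shiftPart, Matrix.of_apply]
      split_ifs
      · have h2 := hE (β / n) (by positivity) r.2 q.2
        rw [norm_mul, toComplex, show Complex.I * (Real.sqrt (β / n) : ℝ) * (h q.1 q.2 : ℂ)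
          = ((Real.sqrt (β / n) * h q.1 q.2 : ℝ) : ℂ) * Complex.I by push_cast; ring,
          Complex.norm_exp_ofReal_mul_I, mul_one]
        simp only [Pi.zero_apply, mul_zero, Complex.exp_zero, mul_one]
        exact (Complex.norm_of_nonneg' h2).le
      · simp
    calc _ ≤ ((∑ r, ‖(shiftPart w β E n (toComplex h) ^ k) p r‖ *
          ‖shiftPart w β E n (toComplex h) r q‖ : ℝ) : ℂ) := by
          rw [Complex.real_le_real]
          exact (norm_sum_le _ _).trans (Finset.sum_le_sum fun r _ => (norm_mul _ _).le)
      _ ≤ _ := by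
          push_cast
          refine Finset.sum_le_sum fun r _ => ?_
          exact mul_le_mul (ih p r) (h1 r) (by simp)
            (le_trans (by simp) (ih p r))

lemma norm_Cov_le {w β : ℝ} (hβ : 0 < β) {E : Matrix X X ℂ}
    (hE : GeneratesStochasticProcess w E) {n : ℕ} (h : Fin (n + 1) → X → ℝ)
    (p q : Fin (n + 1) × X) :
    ((‖Cov w β E n (toComplex h) p q‖ : ℝ) : ℂ) ≤ Cov w β E n 0 p q := by
  simp only [Cov_eq_geom_sum, Matrix.sum_apply]
  calc _ ≤ ((∑ k ∈ Finset.range (n + 1), ‖(shiftPart w β E n (toComplex h) ^ k) p q‖ : ℝ) : ℂ) := by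
        rw [Complex.real_le_real]
        exact norm_sum_le _ _
    _ ≤ _ := by
        push_cast
        exact Finset.sum_le_sum fun k _ => norm_shiftPart_pow_le hβ hE h k p q

end Covariance

/-! ### Matrix elements in coherent states -/

section MatrixElement

variable {X : Type} [Fintype X] [DecidableEq X]

/-- The inclusion of the symmetric functions into all functions of `N` sites. -/
def symmIncl (X : Type) (w : ℝ) (N : ℕ) : BosonSpace X w N →ₗ[ℂ] ((Fin N → X) → ℂ) :=
  (bosonSubmodule X N).subtype

omit [Fintype X] [DecidableEq X] in
lemma symmetrize_symmIncl (w : ℝ) (N : ℕ) (ψ : BosonSpace X w N) :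
    symmetrize X w N (symmIncl X w N ψ) = ψ := by
  refine Subtype.ext (funext fun x => ?_)
  change (N.factorial : ℂ)⁻¹ * ∑ π : Equiv.Perm (Fin N), ψ.1 (x ∘ π) = ψ.1 x
  have h : (N.factorial : ℂ) ≠ 0 := by exact_mod_cast N.factorial_ne_zero
  rw [Finset.sum_congr rfl fun π _ => ψ.2 π x]
  simp [Fintype.card_perm, h]

omit [Fintype X] [DecidableEq X] in
lemma symmetrize_comp_symmIncl (w : ℝ) (N : ℕ) :
    symmetrize X w N ∘ₗ symmIncl X w N = LinearMap.id :=
  LinearMap.ext fun ψ => symmetrize_symmIncl w N ψ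

/-- The kernel of an operator on the `N`-boson space, extended by zero to the orthogonal complement
of the symmetric functions. -/
noncomputable def bosonKernel {w : ℝ} {N : ℕ} (G : BosonSpace X w N →ₗ[ℂ] BosonSpace X w N) :
    Matrix (Fin N → X) (Fin N → X) ℂ :=
  LinearMap.toMatrix' (symmIncl X w N ∘ₗ G ∘ₗ symmetrize X w N)

lemma symmIncl_apply_eq_bosonKernel_mulVec {w : ℝ} {N : ℕ}
    (G : BosonSpace X w N →ₗ[ℂ] BosonSpace X w N) (ψ : BosonSpace X w N) :
    symmIncl X w N (G ψ) = bosonKernel G *ᵥ symmIncl X w N ψ := by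
  rw [bosonKernel, LinearMap.toMatrix'_mulVec]
  simp [symmetrize_symmIncl]

/-- Outputs of the operator are symmetric. This absorbs the permutations produced by Wick's theorem.
-/
lemma bosonKernel_comp_perm {w : ℝ} {N : ℕ} (G : BosonSpace X w N →ₗ[ℂ] BosonSpace X w N)
    (π : Equiv.Perm (Fin N)) (y z : Fin N → X) : bosonKernel G (y ∘ π) z = bosonKernel G y z := by
  simp only [bosonKernel, LinearMap.toMatrix'_apply]
  exact (G _).2 π y

lemma inner_coherent_single (w : ℝ) [Fact (0 < w)] (N : ℕ) (b : X → ℂ) (ψ : BosonSpace X w N) :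
    inner ℂ (coherent w b) (lp.single 2 N ψ : FockSpace X w)
      = inner ℂ ((N.factorial : ℂ)⁻¹ • creationPow w b N) ψ := by
  rw [lp.inner_single_right]
  rfl

/-- Each coherent state contributes `√N! / N!`, which leaves `1 / N!`; the sum over configurations
is the expanded `N`-th power. -/
lemma matrixElement_zero (w : ℝ) [Fact (0 < w)] (N : ℕ) (b a : X → ℂ) :
    matrixElement w N 0 b a
      = 1 / (N.factorial : ℂ) * bili w (fun x => conj (b x)) a ^ N := by
  have hN : (N.factorial : ℂ) ≠ 0 := by exact_mod_cast N.factorial_ne_zero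
  have hs : ((Real.sqrt N.factorial : ℝ) : ℂ) * ((Real.sqrt N.factorial : ℝ) : ℂ)
      = N.factorial := by
    rw [← Complex.ofReal_mul, Real.mul_self_sqrt (Nat.cast_nonneg _), Complex.ofReal_natCast]
  have h1 : (1 + (0 : BosonSpace X w N →ₗ[ℂ] BosonSpace X w N)) (coherent w a N)
      = (N.factorial : ℂ)⁻¹ • creationPow w a N := by
    rw [add_zero]; rfl
  have h2 : (∑ x, conj (b x) * a x) ^ N
      = ∑ y : Fin N → X, (∏ i, conj (b (y i))) * ∏ i, a (y i) := by
    rw [← Fin.prod_const N (∑ x, conj (b x) * a x), Finset.prod_univ_sum, Fintype.piFinset_univ]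
    simp only [Finset.prod_mul_distrib]
  rw [matrixElement, inner_coherent_single, h1, inner_smul_left, inner_smul_right, bosonSpace_inner]
  simp only [creationPow_apply, map_mul, map_prod, map_inv₀, map_natCast, Complex.conj_ofReal]
  rw [bili, mul_pow, h2]
  have h3 : ∑ y : Fin N → X, ((Real.sqrt N.factorial : ℝ) : ℂ) * (∏ i, conj (b (y i))) *
      (((Real.sqrt N.factorial : ℝ) : ℂ) * ∏ i, a (y i))
      = N.factorial * ∑ y : Fin N → X, (∏ i, conj (b (y i))) * ∏ i, a (y i) := by
    rw [← hs, Finset.mul_sum]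
    exact Finset.sum_congr rfl fun y _ => by ring
  rw [h3]
  field_simp

/-- Puts a general matrix element into the form the chain integral accepts: monomials in `conj b`
and `a`. -/
lemma matrixElement_eq_sum (w : ℝ) [Fact (0 < w)] (N : ℕ)
    (F : BosonSpace X w N →ₗ[ℂ] BosonSpace X w N) (b a : X → ℂ) :
    matrixElement w N F b a = (w : ℂ) ^ N * (N.factorial : ℂ)⁻¹ *
      ∑ y, ∑ z, bosonKernel (1 + F) y z * ((∏ i, conj (b (y i))) * ∏ i, a (z i)) := by
  have hN : (N.factorial : ℂ) ≠ 0 := by exact_mod_cast N.factorial_ne_zero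
  have hs : ((Real.sqrt N.factorial : ℝ) : ℂ) * ((Real.sqrt N.factorial : ℝ) : ℂ)
      = N.factorial := by
    rw [← Complex.ofReal_mul, Real.mul_self_sqrt (Nat.cast_nonneg _), Complex.ofReal_natCast]
  have hs0 : ((Real.sqrt N.factorial : ℝ) : ℂ) ≠ 0 := fun h => hN (by rw [← hs, h, zero_mul])
  have h1 (y : Fin N → X) : ((1 + F) (coherent w a N)).1 y
      = (N.factorial : ℂ)⁻¹ * ∑ z, bosonKernel (1 + F) y z *
        (((Real.sqrt N.factorial : ℝ) : ℂ) * ∏ i, a (z i)) := by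
    have := congrFun (symmIncl_apply_eq_bosonKernel_mulVec (1 + F) (coherent w a N)) y
    refine this.trans ?_
    simp only [Matrix.mulVec, dotProduct, Finset.mul_sum]
    refine Finset.sum_congr rfl fun z _ => ?_
    have h2 : symmIncl X w N (coherent w a N) z
        = (N.factorial : ℂ)⁻¹ * (creationPow w a N).1 z := rfl
    rw [h2, creationPow_apply]
    ring
  rw [matrixElement, inner_coherent_single, inner_smul_left, bosonSpace_inner]
  simp only [h1, creationPow_apply, map_mul, map_prod, map_inv₀, map_natCast, Complex.conj_ofReal,
    Finset.mul_sum]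
  refine Finset.sum_congr rfl fun y _ => Finset.sum_congr rfl fun z _ => ?_
  rw [← hs]
  field_simp

end MatrixElement

/-! ### The integral over the boson fields -/

section FieldIntegral

variable {X : Type} [Fintype X] [DecidableEq X]

/-- Counts permutations by the configuration they produce from `y`. -/
lemma sum_mul_permCount {N : ℕ} (y : Fin N → X) (f : (Fin N → X) → ℂ) :
    ∑ u, f u * permCount y u = ∑ π : Equiv.Perm (Fin N), f (y ∘ π) := by
  have h (u : Fin N → X) : f u * permCount y u
      = ∑ π : Equiv.Perm (Fin N), if y ∘ π = u then f u else 0 := by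
    rw [permCount, Fintype.card_subtype, Finset.sum_ite, Finset.sum_const_zero, add_zero,
      Finset.sum_const, nsmul_eq_mul, mul_comm]
  simp only [h]
  rw [Finset.sum_comm]
  simp

lemma integrand_eq_sum {w : ℝ} [Fact (0 < w)] {β : ℝ} {E : Matrix X X ℂ} {N : ℕ}
    (F : BosonSpace X w N →ₗ[ℂ] BosonSpace X w N) {n : ℕ} (h : Fin (n + 1) → X → ℝ) :
    integrand w β E N F n h = fun a => ∑ y, ∑ z,
      ((w : ℂ) ^ N * (N.factorial : ℂ)⁻¹ * bosonKernel (1 + F) y z) *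
        chainIntegrand w (hopping w β E n (toComplex h)) y z a := by
  funext a
  rw [integrand, neg_quadForm, matrixElement_eq_sum]
  simp only [Finset.mul_sum, chainIntegrand]
  exact Finset.sum_congr rfl fun y _ => Finset.sum_congr rfl fun z _ => by ring

variable {w : ℝ} [hw : Fact (0 < w)] {β : ℝ} {E : Matrix X X ℂ}

lemma integrable_integrand (hE : E.PosDef) (hβ : 0 < β) {N : ℕ}
    (F : BosonSpace X w N →ₗ[ℂ] BosonSpace X w N) {n : ℕ} (hn : 1 ≤ n)
    (h : Fin (n + 1) → X → ℝ) : Integrable (integrand w β E N F n h) (fieldMeasure X w n) := by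
  have hn' : (0 : ℝ) < n := by exact_mod_cast hn
  obtain ⟨c, hc, hc1, hcontr⟩ := exists_contractsBy_heat hE hw.out (div_pos hβ hn')
  refine Integrable.smul_measure ?_ ENNReal.ofReal_ne_top
  rw [integrand_eq_sum]
  exact integrable_finsetSum _ fun y _ => integrable_finsetSum _ fun z _ =>
    (integrable_chainIntegrand hw.out hc hc1 (contractsBy_hopping hcontr h) y z).const_mul _

/-- The integral over the boson fields is a trace. -/
lemma integral_integrand (hE : E.PosDef) (hβ : 0 < β) {N : ℕ}
    (F : BosonSpace X w N →ₗ[ℂ] BosonSpace X w N) {n : ℕ} (hn : 1 ≤ n)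
    (h : Fin (n + 1) → X → ℝ) :
    ∫ a, integrand w β E N F n h a ∂(fieldMeasure X w n) =
      (bosonKernel (1 + F) *
        tensorPow N (List.ofFn (hopping w β E n (toComplex h))).prod).trace := by
  have hn' : (0 : ℝ) < n := by exact_mod_cast hn
  have hw0 := hw.out
  have hwc : (w : ℂ) ≠ 0 := by exact_mod_cast hw0.ne'
  have hpi : (Real.pi : ℂ) ≠ 0 := by exact_mod_cast Real.pi_ne_zero
  obtain ⟨c, hc, hc1, hcontr⟩ := exists_contractsBy_heat hE hw0 (div_pos hβ hn')
  have hcontr := contractsBy_hopping hcontr h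
  set K := bosonKernel (1 + F) with hK
  set T := tensorPow N (List.ofFn (hopping w β E n (toComplex h))).prod with hT
  have hN : (N.factorial : ℂ) ≠ 0 := by exact_mod_cast N.factorial_ne_zero
  have hint (y z : Fin N → X) :=
    (integrable_chainIntegrand hw0 hc hc1 hcontr y z).const_mul
      ((w : ℂ) ^ N * (N.factorial : ℂ)⁻¹ * K y z)
  rw [fieldMeasure, integral_smul_measure, ENNReal.toReal_ofReal (by positivity),
    integrand_eq_sum, integral_finsetSum _ fun y _ => integrable_finsetSum _ fun z _ => hint y z]
  have h1 (y : Fin N → X) : ∫ a, ∑ z, ((w : ℂ) ^ N * (N.factorial : ℂ)⁻¹ * K y z) *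
      chainIntegrand w (hopping w β E n (toComplex h)) y z a
      = ((Real.pi / w : ℂ) ^ Fintype.card X) ^ (n + 1) *
        ((N.factorial : ℂ)⁻¹ * ∑ π : Equiv.Perm (Fin N), ∑ z, K (y ∘ π) z * T z (y ∘ π)) := by
    rw [integral_finsetSum _ fun z _ => hint y z]
    simp only [integral_const_mul, integral_chainIntegrand hw0 hc hc1 hcontr, ← hT,
      sum_mul_permCount, hK, bosonKernel_comp_perm]
    rw [Finset.sum_comm, Finset.mul_sum, Finset.mul_sum]
    refine Finset.sum_congr rfl fun z _ => ?_
    rw [← Finset.mul_sum]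
    field_simp
  simp only [h1]
  rw [← Finset.mul_sum, ← Finset.mul_sum, Finset.sum_comm]
  -- Summing over all `y` makes the permutation a mere relabelling, so the `N!` permutations give
  -- equal traces and cancel `1 / N!`.
  have h2 (π : Equiv.Perm (Fin N)) : ∑ y : Fin N → X, ∑ z, K (y ∘ π) z * T z (y ∘ π)
      = (K * T).trace :=
    Equiv.sum_comp (π.arrowCongr (Equiv.refl X)).symm (fun y => ∑ z, K y z * T z y)
  simp only [h2, Finset.sum_const, Finset.card_univ, Fintype.card_perm, Fintype.card_fin,
    nsmul_eq_mul]
  -- The normalization `(w / π)^{(n+1)|X|}` of the field measure cancels one factor `π / w` per time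
  -- and site.
  rw [inv_mul_cancel_left₀ hN, Complex.real_smul, ← mul_assoc, ← pow_mul, mul_comm (n + 1)]
  push_cast
  rw [← mul_pow, div_mul_div_cancel₀ hpi, div_self hwc, one_pow, one_mul]

end FieldIntegral

/-! ### The integral over the auxiliary field -/

section Auxiliary

/-- By independence the mean of a matrix product is the product of the means. Integrability is
carried along because each use of Fubini needs it. -/
lemma integrable_and_integral_list_prod {Ω ι : Type} [Fintype ι] [DecidableEq ι]
    [MeasurableSpace Ω] (μ : Measure Ω) [IsProbabilityMeasure μ] {B : Ω → Matrix ι ι ℂ}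
    (hB : ∀ i k, Integrable (fun ω => B ω i k) μ) (n : ℕ) : ∀ i k,
      Integrable (fun h : Fin n → Ω => (List.ofFn fun j => B (h j)).prod i k)
        (Measure.pi fun _ => μ) ∧
      ∫ h : Fin n → Ω, (List.ofFn fun j => B (h j)).prod i k ∂(Measure.pi fun _ => μ)
        = ((Matrix.of fun i k => ∫ ω, B ω i k ∂μ) ^ n) i k := by
  induction n with
  | zero => intro i k; simp
  | succ n ih =>
    intro i k
    have hmp := (measurePreserving_piFinSuccAbove (fun _ : Fin (n + 1) => μ) 0).symm
    have hcons (p : Ω × (Fin n → Ω)) :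
        (List.ofFn fun j => B ((MeasurableEquiv.piFinSuccAbove (fun _ : Fin (n + 1) => Ω) 0).symm
          p j)).prod i k = ∑ l, B p.1 i l * (List.ofFn fun j => B (p.2 j)).prod l k := by
      rw [List.ofFn_succ, List.prod_cons, Matrix.mul_apply]
      simp [MeasurableEquiv.piFinSuccAbove_symm_apply, Fin.insertNthEquiv]
    have hint (l : ι) : Integrable (fun p : Ω × (Fin n → Ω) =>
        B p.1 i l * (List.ofFn fun j => B (p.2 j)).prod l k) (μ.prod (Measure.pi fun _ => μ)) :=
      (hB i l).mul_prod (ih l k).1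
    constructor
    · rw [← hmp.integrable_comp_emb (MeasurableEquiv.measurableEmbedding _)]
      refine (integrable_finsetSum Finset.univ fun l _ => hint l).congr
        (Eventually.of_forall fun p => ?_)
      exact (hcons p).symm
    · rw [← hmp.integral_comp']
      simp only [hcons]
      refine (integral_finsetSum _ fun l _ => hint l).trans ?_
      rw [pow_succ', Matrix.mul_apply]
      refine Finset.sum_congr rfl fun l _ => ?_
      refine (integral_prod_mul (fun ω => B ω i l)
        (fun h : Fin n → Ω => (List.ofFn fun j => B (h j)).prod l k)).trans ?_
      rw [(ih l k).2, Matrix.of_apply]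

variable {X : Type} [Fintype X] [DecidableEq X]

/-- The interaction energy of a configuration. -/
noncomputable def interaction (v : Matrix X X ℝ) {N : ℕ} (y : Fin N → X) : ℝ :=
  1 / 2 * ∑ i, ∑ j, v (y i) (y j)

/-- The centered Gaussian measure on `ℝ^X` with covariance `v`. -/
noncomputable def siteMeasure (v : Matrix X X ℝ) : Measure (X → ℝ) :=
  (multivariateGaussian (0 : EuclideanSpace ℝ X) v).map WithLp.ofLp

instance (v : Matrix X X ℝ) : IsProbabilityMeasure (siteMeasure v) :=
  Measure.isProbabilityMeasure_map (by fun_prop)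

omit [Fintype X] [DecidableEq X] in
lemma continuous_phase {N : ℕ} (s : ℝ) (y : Fin N → X) : Continuous fun h : X → ℝ =>
    Complex.exp (Complex.I * s * ∑ i, (h (y i) : ℂ)) := by
  fun_prop

/-- The Hubbard–Stratonovich identity: the Gaussian characteristic function produces the interaction
energy, including the terms `i = j`. -/
lemma integral_phase {v : Matrix X X ℝ} (hv : v.PosSemidef) {N : ℕ} (s : ℝ) (y : Fin N → X) :
    ∫ h, Complex.exp (Complex.I * s * ∑ i, (h (y i) : ℂ)) ∂(siteMeasure v)
      = Complex.exp (-(s ^ 2 * interaction v y : ℝ)) := by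
  -- `t` is `s` times the occupation vector of `y`, so `⟨h, t⟩ = s ∑ h(y_i)`.
  set t : EuclideanSpace ℝ X := WithLp.toLp 2 fun x => s * ∑ i, if y i = x then 1 else 0 with ht
  have htx (x : X) : t x = s * ∑ i, if y i = x then 1 else 0 := rfl
  have hsum (f : X → ℝ) : ∑ x, f x * t x = s * ∑ i, f (y i) := by
    simp only [htx, Finset.mul_sum]
    rw [Finset.sum_comm]
    refine Finset.sum_congr rfl fun i _ => ?_
    simp [mul_comm]
  have h1 := charFun_multivariateGaussian (μ := (0 : EuclideanSpace ℝ X)) hv t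
  rw [charFun_apply] at h1
  rw [siteMeasure, integral_map (by fun_prop) (continuous_phase s y).aestronglyMeasurable]
  refine Eq.trans (integral_congr_ae (Eventually.of_forall fun g => ?_)) (h1.trans ?_)
  · simp only [PiLp.inner_apply, RCLike.inner_apply, conj_trivial]
    congr 1
    have := hsum g
    simp only [mul_comm] at this ⊢
    rw [this]
    push_cast
    ring
  · rw [inner_zero_right]
    have h2 : t.ofLp ⬝ᵥ v *ᵥ t.ofLp = s ^ 2 * ∑ i, ∑ j, v (y i) (y j) := by
      simp only [dotProduct, Matrix.mulVec]
      simp only [hsum]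
      have := hsum fun x => s * ∑ j, v x (y j)
      simp only [mul_comm (t.ofLp _)]
      rw [this, ← Finset.mul_sum]
      ring
    rw [h2, interaction]
    congr 1
    push_cast
    ring

/-- One time step of the Trotter product. -/
noncomputable def trotterStep (w : ℝ) (E : Matrix X X ℂ) (v : Matrix X X ℝ) (N : ℕ) (ε : ℝ) :
    Matrix (Fin N → X) (Fin N → X) ℂ :=
  tensorPow N (heat w ε E) * Matrix.diagonal fun y => ((Real.exp (-(ε * interaction v y)) : ℝ) : ℂ)

/-- One time step in the presence of an auxiliary field. -/
noncomputable def fieldStep (w : ℝ) (E : Matrix X X ℂ) (N : ℕ) (ε : ℝ) (h : X → ℝ) :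
    Matrix (Fin N → X) (Fin N → X) ℂ :=
  tensorPow N (heat w ε E) * Matrix.diagonal fun y =>
    Complex.exp (Complex.I * (Real.sqrt ε : ℝ) * ∑ i, (h (y i) : ℂ))

lemma integrable_fieldStep (w : ℝ) (E : Matrix X X ℂ) (v : Matrix X X ℝ) (N : ℕ) (ε : ℝ)
    (y z : Fin N → X) : Integrable (fun h => fieldStep w E N ε h y z) (siteMeasure v) := by
  simp only [fieldStep, Matrix.mul_diagonal]
  refine Integrable.const_mul ?_ _
  refine Integrable.of_bound (continuous_phase _ z).aestronglyMeasurable 1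
    (Eventually.of_forall fun h => ?_)
  rw [show Complex.I * (Real.sqrt ε : ℝ) * ∑ i, (h (z i) : ℂ)
    = ((Real.sqrt ε * ∑ i, h (z i) : ℝ) : ℂ) * Complex.I by push_cast; ring,
    Complex.norm_exp_ofReal_mul_I]

/-- The factor `√ε` in the phase is squared by the Gaussian average, giving an interaction over time
`ε`. -/
lemma integral_fieldStep (w : ℝ) (E : Matrix X X ℂ) {v : Matrix X X ℝ} (hv : v.PosSemidef) (N : ℕ)
    {ε : ℝ} (hε : 0 ≤ ε) :
    (Matrix.of fun y z => ∫ h, fieldStep w E N ε h y z ∂(siteMeasure v))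
      = trotterStep w E v N ε := by
  ext y z
  simp only [fieldStep, Matrix.mul_diagonal, Matrix.of_apply, trotterStep]
  rw [integral_const_mul, integral_phase hv, Real.sq_sqrt hε, ← Complex.ofReal_neg,
    Complex.ofReal_exp]

/-- The site phases of the `N` particles multiply to one phase. Only `h_1, …, h_n` enter. -/
lemma tensorPow_hopping (w β : ℝ) (E : Matrix X X ℂ) (N n : ℕ) (h : Fin (n + 1) → X → ℝ) :
    tensorPow N (List.ofFn (hopping w β E n (toComplex h))).prod
      = (List.ofFn fun j => fieldStep w E N (β / n) (Fin.tail h j)).prod := by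
  rw [tensorPow_list_prod, List.map_ofFn]
  congr 2
  funext j
  simp only [Function.comp, hopping, fieldStep, tensorPow_mul, tensorPow_diagonal, toComplex,
    Fin.tail, ← Complex.exp_sum, Finset.mul_sum]

/-- `h_0` is an idle variable of total mass one. -/
lemma measurePreserving_tail (v : Matrix X X ℝ) (n : ℕ) :
    MeasurePreserving (fun h : Fin (n + 1) → X → ℝ => Fin.tail h) (auxMeasure v n)
      (Measure.pi fun _ : Fin n => siteMeasure v) :=
  measurePreserving_snd.comp
    (measurePreserving_piFinSuccAbove (fun _ : Fin (n + 1) => siteMeasure v) 0)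

/-- For every `n ≥ 1` the sliced integral is exactly a Trotter trace; only the limit of matrix
powers remains. -/
lemma integrable_and_integral_aux {w : ℝ} [hw : Fact (0 < w)] {β : ℝ} {E : Matrix X X ℂ}
    (hE : E.PosDef) {v : Matrix X X ℝ} (hv : v.PosSemidef) (hβ : 0 < β) {N : ℕ}
    (F : BosonSpace X w N →ₗ[ℂ] BosonSpace X w N) {n : ℕ} (hn : 1 ≤ n) :
    Integrable (fun h => ∫ a, integrand w β E N F n h a ∂(fieldMeasure X w n)) (auxMeasure v n) ∧
    canonicalZSliced w β E v N F n
      = (bosonKernel (1 + F) * trotterStep w E v N (β / n) ^ n).trace := by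
  have hε : 0 ≤ β / n := by positivity
  have key := integrable_and_integral_list_prod (siteMeasure v)
    (integrable_fieldStep w E v N (β / n)) n
  rw [integral_fieldStep w E hv N hε] at key
  set K := bosonKernel (1 + F) with hK
  have hint (y z : Fin N → X) : Integrable (fun h : Fin n → X → ℝ =>
      K y z * (List.ofFn fun j => fieldStep w E N (β / n) (h j)).prod z y)
      (Measure.pi fun _ => siteMeasure v) := (key z y).1.const_mul _
  have hfun (h : Fin (n + 1) → X → ℝ) : ∫ a, integrand w β E N F n h a ∂(fieldMeasure X w n)
      = (fun h : Fin n → X → ℝ => ∑ y, ∑ z,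
        K y z * (List.ofFn fun j => fieldStep w E N (β / n) (h j)).prod z y) (Fin.tail h) := by
    rw [integral_integrand hE hβ F hn, tensorPow_hopping]
    rfl
  have hint' := integrable_finsetSum Finset.univ fun y _ =>
    integrable_finsetSum Finset.univ fun z _ => hint y z
  have hmp := measurePreserving_tail v n
  constructor
  · simp only [hfun]
    exact hmp.integrable_comp_of_integrable hint'
  · rw [canonicalZSliced]
    refine (integral_congr_ae (Eventually.of_forall hfun)).trans
      ((integral_map hmp.measurable.aemeasurable
        (by rw [hmp.map_eq]; exact hint'.aestronglyMeasurable)).symm.trans ?_)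
    rw [hmp.map_eq, integral_finsetSum _ fun y _ => integrable_finsetSum _ fun z _ => hint y z]
    simp only [Matrix.trace, Matrix.diag, Matrix.mul_apply]
    refine Finset.sum_congr rfl fun y _ => ?_
    rw [integral_finsetSum _ fun z _ => hint y z]
    exact Finset.sum_congr rfl fun z _ => by rw [integral_const_mul, (key z y).2]

end Auxiliary

/-! ### Chernoff's product formula -/

section Chernoff

variable {𝔸 : Type*} [NormedRing 𝔸] [NormOneClass 𝔸]

/-- Telescoping: one factor at a time is exchanged, the others being bounded by `r`. -/
lemma norm_pow_sub_pow_le {a b : 𝔸} {r : ℝ} (hr : 1 ≤ r) (ha : ‖a‖ ≤ r) (hb : ‖b‖ ≤ r) (n : ℕ) :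
    ‖a ^ n - b ^ n‖ ≤ n * r ^ n * ‖a - b‖ := by
  have hr0 : 0 ≤ r := zero_le_one.trans hr
  induction n with
  | zero => simp
  | succ n ih =>
    have h1 : a ^ (n + 1) - b ^ (n + 1) = a ^ n * (a - b) + (a ^ n - b ^ n) * b := by
      rw [pow_succ, pow_succ]; noncomm_ring
    have h2 : ‖a ^ n‖ ≤ r ^ n := (norm_pow_le a n).trans (pow_le_pow_left₀ (norm_nonneg _) ha n)
    calc _ ≤ ‖a ^ n‖ * ‖a - b‖ + ‖a ^ n - b ^ n‖ * ‖b‖ := by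
          rw [h1]
          exact (norm_add_le _ _).trans (add_le_add (norm_mul_le _ _) (norm_mul_le _ _))
      _ ≤ r ^ (n + 1) * ‖a - b‖ + n * r ^ n * ‖a - b‖ * r := by
          gcongr
          exact h2.trans (pow_le_pow_right₀ hr n.le_succ)
      _ = _ := by push_cast; ring

variable [NormedAlgebra ℝ 𝔸]

lemma tendsto_div_nhdsNE {t : ℝ} (ht : 0 < t) :
    Tendsto (fun n : ℕ => t / n) atTop (𝓝[≠] 0) := by
  refine tendsto_nhdsWithin_iff.2 ⟨tendsto_const_div_atTop_nhds_zero_nat t, ?_⟩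
  filter_upwards [eventually_gt_atTop 0] with n hn
  have : (0 : ℝ) < n := by exact_mod_cast hn
  exact (div_pos ht this).ne'

/-- Difference quotients are eventually shorter than `‖A‖ + 1`. The `n`-th powers are then bounded
by `e^{(‖A‖+1)t}`, uniformly in `n`. -/
lemma eventually_norm_le_exp {S : ℝ → 𝔸} {A : 𝔸} (h0 : S 0 = 1) (hS : HasDerivAt S A 0) {t : ℝ}
    (ht : 0 < t) : ∀ᶠ n : ℕ in atTop, ‖S (t / n)‖ ≤ Real.exp ((‖A‖ + 1) * (t / n)) := by
  have h1 := (hS.tendsto_slope_zero.comp (tendsto_div_nhdsNE ht)).norm.eventually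
    (gt_mem_nhds (lt_add_one ‖A‖))
  filter_upwards [h1, eventually_gt_atTop 0] with n h2 hn
  have hn' : (0 : ℝ) < n := by exact_mod_cast hn
  set s := t / n
  have hs : 0 < s := div_pos ht hn'
  simp only [Function.comp, zero_add, h0] at h2
  rw [norm_smul, norm_inv, Real.norm_of_nonneg hs.le, inv_mul_lt_iff₀ hs] at h2
  calc ‖S s‖ = ‖1 + (S s - 1)‖ := by rw [add_sub_cancel]
    _ ≤ 1 + s * (‖A‖ + 1) := (norm_add_le _ _).trans (by rw [norm_one]; gcongr)
    _ ≤ _ := by linarith [Real.add_one_le_exp ((‖A‖ + 1) * s)]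

/-- Chernoff's product formula for families that are differentiable in norm. -/
lemma tendsto_pow_of_hasDerivAt [CompleteSpace 𝔸] {S : ℝ → 𝔸} {A : 𝔸} (h0 : S 0 = 1)
    (hS : HasDerivAt S A 0) {t : ℝ} (ht : 0 < t) :
    Tendsto (fun n : ℕ => S (t / n) ^ n) atTop (𝓝 (NormedSpace.exp (t • A))) := by
  set R : ℝ → 𝔸 := fun s => NormedSpace.exp (s • A)
  have hR0 : R 0 = 1 := by simp [R]
  have hR : HasDerivAt R A 0 := by
    simpa using hasDerivAt_exp_smul_const (𝕂 := ℝ) A (0 : ℝ)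
  -- `S` and the semigroup `R` have the same derivative at `0`, so `S(t/n) - R(t/n)` is `o(1/n)`,
  -- which beats the `n` telescoped terms.
  have hD := ((hS.sub hR).tendsto_slope_zero.comp (tendsto_div_nhdsNE ht)).norm
  rw [sub_self, norm_zero] at hD
  have hlim := hD.const_mul (t * Real.exp ((‖A‖ + 1) * t))
  rw [mul_zero] at hlim
  refine tendsto_iff_norm_sub_tendsto_zero.2 (squeeze_zero' (Eventually.of_forall fun n =>
    norm_nonneg _) ?_ hlim)
  filter_upwards [eventually_norm_le_exp h0 hS ht, eventually_norm_le_exp hR0 hR ht,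
    eventually_gt_atTop 0] with n h1 h2 hn
  have hn' : (0 : ℝ) < n := by exact_mod_cast hn
  have h3 : NormedSpace.exp (t • A) = R (t / n) ^ n := by
    let : NormedAlgebra ℚ 𝔸 := NormedAlgebra.restrictScalars ℚ ℝ 𝔸
    simp only [R]
    rw [← NormedSpace.exp_nsmul, ← Nat.cast_smul_eq_nsmul ℝ, smul_smul, mul_div_cancel₀ _ hn'.ne']
  rw [h3]
  refine (norm_pow_sub_pow_le (Real.one_le_exp (by positivity)) h1 h2 n).trans (le_of_eq ?_)
  simp only [Function.comp, zero_add, Pi.sub_apply, h0, hR0, sub_self, sub_zero]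
  rw [norm_smul, norm_inv, Real.norm_of_nonneg (by positivity), ← Real.exp_nat_mul]
  have h4 : (n : ℝ) * ((‖A‖ + 1) * (t / n)) = (‖A‖ + 1) * t := by field_simp
  rw [h4]
  field_simp

end Chernoff

/-! ### The Hamiltonian as an operator on functions -/

section Hamiltonian

variable {X : Type} [Fintype X] [DecidableEq X]

omit [Fintype X] in
-- Permutations are grouped by `π 0 = i`, the particle in the created slot. Each group has `n!`
-- members, and the two factors `√(n+1)` complete the cancellation of `(n+1)!`.
lemma hop_apply {w : ℝ} (x u : X) (N : ℕ) (ψ : BosonSpace X w N) (y : Fin N → X) :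
    symmIncl X w N (hop w x u N ψ) y
      = (w : ℂ)⁻¹ * ∑ i, if y i = x then symmIncl X w N ψ (Function.update y i u) else 0 := by
  cases N with
  | zero => simp [hop]
  | succ n =>
    have hs : ((Real.sqrt (n + 1) : ℝ) : ℂ) * ((Real.sqrt (n + 1) : ℝ) : ℂ) = n + 1 := by
      rw [← Complex.ofReal_mul, Real.mul_self_sqrt (by positivity)]
      push_cast
      rfl
    have key : symmIncl X w (n + 1) (hop w x u (n + 1) ψ) y
        = ((Real.sqrt (n + 1) : ℝ) : ℂ) * ((((n + 1).factorial : ℂ))⁻¹ *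
          ∑ π : Equiv.Perm (Fin (n + 1)), (if (y ∘ π) 0 = x then (w : ℂ)⁻¹ else 0) *
            (((Real.sqrt (n + 1) : ℝ) : ℂ) * ψ.1 (Fin.cons u (Fin.tail (y ∘ π))))) := rfl
    have h1 (π : Equiv.Perm (Fin (n + 1))) : ψ.1 (Fin.cons u (Fin.tail (y ∘ π)))
        = symmIncl X w (n + 1) ψ (Function.update y (π 0) u) := by
      have h2 : (Fin.cons u (Fin.tail (y ∘ π)) : Fin (n + 1) → X)
          = Function.update y (π 0) u ∘ π := by
        funext i
        refine Fin.cases ?_ (fun j => ?_) i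
        · simp
        · simp [Fin.tail]
      rw [h2]
      exact ψ.2 π _
    have h3 : ∑ π : Equiv.Perm (Fin (n + 1)), (if (y ∘ π) 0 = x then (w : ℂ)⁻¹ else 0) *
            (((Real.sqrt (n + 1) : ℝ) : ℂ) * ψ.1 (Fin.cons u (Fin.tail (y ∘ π))))
        = (n.factorial : ℂ) * ∑ i, (if y i = x then (w : ℂ)⁻¹ else 0) *
            (((Real.sqrt (n + 1) : ℝ) : ℂ) *
              symmIncl X w (n + 1) ψ (Function.update y i u)) := by
      simp only [h1, Function.comp]
      rw [← Equiv.sum_comp Equiv.Perm.decomposeFin.symm, Fintype.sum_prod_type, Finset.mul_sum]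
      refine Finset.sum_congr rfl fun i _ => ?_
      simp only [Equiv.Perm.decomposeFin_symm_apply_zero]
      rw [Finset.sum_const, Finset.card_univ, Fintype.card_perm, Fintype.card_fin, nsmul_eq_mul]
    have h4 : (n.factorial : ℂ) ≠ 0 := by exact_mod_cast n.factorial_ne_zero
    have h5 : (n + 1 : ℂ) ≠ 0 := by exact_mod_cast n.succ_ne_zero
    rw [key, h3, Nat.factorial_succ, Finset.mul_sum, Finset.mul_sum, Finset.mul_sum,
      Finset.mul_sum]
    refine Finset.sum_congr rfl fun i _ => ?_
    split_ifs
    · push_cast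
      rw [mul_inv]
      calc _ = (((Real.sqrt (n + 1) : ℝ) : ℂ) * ((Real.sqrt (n + 1) : ℝ) : ℂ)) *
            ((n + 1 : ℂ)⁻¹ * ((n.factorial : ℂ)⁻¹ * n.factorial) *
            ((w : ℂ)⁻¹ * symmIncl X w (n + 1) ψ (Function.update y i u))) := by ring
        _ = _ := by
            rw [hs, inv_mul_cancel₀ h4, mul_one, mul_inv_cancel_left₀ h5]
    · simp

omit [Fintype X] in
lemma density_apply {w : ℝ} (x : X) (N : ℕ) (ψ : BosonSpace X w N) (y : Fin N → X) :
    symmIncl X w N (density w x N ψ) y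
      = (w : ℂ)⁻¹ * (∑ i, if y i = x then 1 else 0) * symmIncl X w N ψ y := by
  rw [density, hop_apply, mul_assoc, Finset.sum_mul]
  congr 1
  refine Finset.sum_congr rfl fun i _ => ?_
  split_ifs with h
  · rw [← h, Function.update_eq_self, one_mul]
  · rw [zero_mul]

/-- Hopping keeps one of the two cell volumes and the interaction none. As `n_x n_y` is not normal
ordered, the terms `i = j` remain, matching the Gaussian average. -/
lemma hamiltonian_apply {w : ℝ} (hw : w ≠ 0) (E : Matrix X X ℂ) (v : Matrix X X ℝ) (N : ℕ)
    (ψ : BosonSpace X w N) (y : Fin N → X) :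
    symmIncl X w N (hamiltonian w E v N ψ) y
      = ∑ i, ∑ u, (w : ℂ) * E (y i) u * symmIncl X w N ψ (Function.update y i u) +
        interaction v y * symmIncl X w N ψ y := by
  have hwc : (w : ℂ) ≠ 0 := by exact_mod_cast hw
  have hsum (f : X → ℂ) (c : ℂ) :
      ∑ x, f x * (c * ∑ i, if y i = x then 1 else 0) = c * ∑ i, f (y i) := by
    simp only [Finset.mul_sum]
    rw [Finset.sum_comm]
    refine Finset.sum_congr rfl fun i _ => ?_
    simp [mul_comm]
  rw [hamiltonian, LinearMap.add_apply, map_add, Pi.add_apply]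
  congr 1
  · simp only [LinearMap.smul_apply, LinearMap.sum_apply, map_smul, map_sum, Pi.smul_apply,
      Finset.sum_apply, hop_apply, smul_eq_mul, Finset.mul_sum]
    simp only [mul_ite, mul_zero]
    rw [Finset.sum_comm]
    conv_lhs => enter [2, u]; rw [Finset.sum_comm]
    rw [Finset.sum_comm]
    refine Finset.sum_congr rfl fun i _ => Finset.sum_congr rfl fun u _ => ?_
    rw [Finset.sum_ite_eq, if_pos (Finset.mem_univ _)]
    field_simp
  · simp only [LinearMap.smul_apply, LinearMap.sum_apply, map_smul, map_sum, Pi.smul_apply,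
      Finset.sum_apply, LinearMap.comp_apply, density_apply, smul_eq_mul]
    have h1 : ∑ x, ∑ u, (v x u : ℂ) * ((w : ℂ)⁻¹ * (∑ i, if y i = x then 1 else 0) *
        ((w : ℂ)⁻¹ * (∑ i, if y i = u then 1 else 0) * symmIncl X w N ψ y))
        = (w : ℂ)⁻¹ * ((w : ℂ)⁻¹ * ∑ i, ∑ j, (v (y i) (y j) : ℂ)) * symmIncl X w N ψ y := by
      have h2 (x u : X) : (v x u : ℂ) * ((w : ℂ)⁻¹ * (∑ i, if y i = x then 1 else 0) *
        ((w : ℂ)⁻¹ * (∑ i, if y i = u then 1 else 0) * symmIncl X w N ψ y))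
        = ((v x u : ℂ) * ((w : ℂ)⁻¹ * ∑ i, if y i = u then 1 else 0)) *
          (((w : ℂ)⁻¹ * ∑ i, if y i = x then 1 else 0) * symmIncl X w N ψ y) := by ring
      simp only [h2, ← Finset.sum_mul, hsum]
      simp only [← mul_assoc, ← Finset.sum_mul]
      congr 1
      have h3 := hsum (fun x => (w : ℂ)⁻¹ * ∑ j, (v x (y j) : ℂ)) (w : ℂ)⁻¹
      simp only [← mul_assoc] at h3
      rw [h3, ← Finset.mul_sum]
      ring
    rw [h1, interaction]
    push_cast
    field_simp

/-- The derivative of the Trotter step at time zero. -/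
noncomputable def generator (w : ℝ) (E : Matrix X X ℂ) (v : Matrix X X ℝ) (N : ℕ) :
    Matrix (Fin N → X) (Fin N → X) ℂ :=
  Matrix.of fun y z =>
    (∑ i, (∏ j ∈ Finset.univ.erase i, (1 : Matrix X X ℂ) (y j) (z j)) * -((w : ℂ) * E (y i) (z i)))
      + (1 : Matrix (Fin N → X) (Fin N → X) ℂ) y z * -(interaction v z : ℂ)

/-- The Kronecker deltas restrict the sum to configurations differing from `y` at most in particle
`i`. -/
lemma sum_prod_erase_mul {N : ℕ} (y : Fin N → X) (i : Fin N) (f : X → ℂ)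
    (g : (Fin N → X) → ℂ) :
    ∑ z : Fin N → X, (∏ j ∈ Finset.univ.erase i, (1 : Matrix X X ℂ) (y j) (z j)) * f (z i) * g z
      = ∑ u, f u * g (Function.update y i u) := by
  symm
  refine Finset.sum_of_injOn (Function.update y i)
    (Function.update_injective y i).injOn (fun _ _ => by simp) (fun z _ hz => ?_) fun u _ => ?_
  · have : ∃ j ∈ Finset.univ.erase i, (1 : Matrix X X ℂ) (y j) (z j) = 0 := by
      by_contra! hcon
      refine hz ⟨z i, by simp, funext fun j => ?_⟩
      by_cases hj : j = i
      · subst hj; simp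
      · rw [Function.update_of_ne hj]
        by_contra hne
        exact hcon j (by simp [hj]) (Matrix.one_apply_ne hne)
    rw [Finset.prod_eq_zero_iff.2 this, zero_mul, zero_mul]
  · rw [Finset.prod_eq_one fun j hj => by
      rw [Function.update_of_ne (Finset.ne_of_mem_erase hj), Matrix.one_apply_eq], one_mul,
      Function.update_self]

lemma symmIncl_hamiltonian {w : ℝ} (hw : w ≠ 0) (E : Matrix X X ℂ) (v : Matrix X X ℝ) (N : ℕ)
    (ψ : BosonSpace X w N) :
    symmIncl X w N (hamiltonian w E v N ψ) = -(generator w E v N *ᵥ symmIncl X w N ψ) := by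
  funext y
  rw [hamiltonian_apply hw, Pi.neg_apply]
  simp only [Matrix.mulVec, dotProduct, generator, Matrix.of_apply, add_mul,
    Finset.sum_add_distrib, Finset.sum_mul]
  rw [neg_add]
  congr 1
  · conv_rhs => rw [Finset.sum_comm]
    rw [← Finset.sum_neg_distrib]
    refine Finset.sum_congr rfl fun i _ => ?_
    rw [sum_prod_erase_mul y i (fun u => -((w : ℂ) * E (y i) u)), ← Finset.sum_neg_distrib]
    exact Finset.sum_congr rfl fun u _ => by ring
  · simp [Matrix.one_apply]

lemma trotterStep_zero (w : ℝ) (E : Matrix X X ℂ) (v : Matrix X X ℝ) (N : ℕ) :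
    trotterStep w E v N 0 = 1 := by
  simp [trotterStep, heat, tensorPow_one]

-- Differentiating the Trotter step and passing to the limit

attribute [local instance] Matrix.linftyOpNormedRing Matrix.linftyOpNormedAlgebra

omit [Fintype X] [DecidableEq X] in
lemma hasDerivAt_matrix_apply {ι : Type} [Fintype ι] [DecidableEq ι] {S : ℝ → Matrix ι ι ℂ}
    {A : Matrix ι ι ℂ} {t : ℝ} (h : HasDerivAt S A t) (i j : ι) :
    HasDerivAt (fun s => S s i j) (A i j) t :=
  (LinearMap.toContinuousLinearMap (Matrix.entryLinearMap ℝ ℂ i j)).hasFDerivAt.comp_hasDerivAt t h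

omit [Fintype X] [DecidableEq X] in
-- Reassembling from elementary matrices passes from entries to the operator norm.
lemma hasDerivAt_matrix_of_apply {ι : Type} [Fintype ι] [DecidableEq ι] {S : ℝ → Matrix ι ι ℂ}
    {A : Matrix ι ι ℂ} {t : ℝ} (h : ∀ i j, HasDerivAt (fun s => S s i j) (A i j) t) :
    HasDerivAt S A t := by
  have h1 (i j : ι) : HasDerivAt (fun s => Matrix.single i j (S s i j))
      (Matrix.single i j (A i j)) t :=
    (LinearMap.toContinuousLinearMap (Matrix.singleLinearMap (α := ℂ) ℝ i j)
      : ℂ →L[ℝ] Matrix ι ι ℂ).hasFDerivAt.comp_hasDerivAt t (h i j)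
  have h2 := HasDerivAt.fun_sum fun i (_ : i ∈ Finset.univ) =>
    HasDerivAt.fun_sum fun j (_ : j ∈ Finset.univ) => h1 i j
  simp only [← Matrix.matrix_eq_sum_single] at h2
  exact h2

lemma hasDerivAt_heat (w : ℝ) (E : Matrix X X ℂ) (x u : X) :
    HasDerivAt (fun ε => heat w ε E x u) (-((w : ℂ) * E x u)) 0 := by
  have h := hasDerivAt_exp_smul_const (𝕂 := ℝ) (-((w : ℂ) • E)) (0 : ℝ)
  rw [zero_smul, NormedSpace.exp_zero, one_mul] at h
  have h1 := hasDerivAt_matrix_apply h x u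
  refine h1.congr_of_eventuallyEq (Eventually.of_forall fun ε => ?_)
  simp only [heat]
  rw [smul_neg]
  rfl

/-- Leibniz rule: one tensor factor is differentiated, the others being the identity at time zero.
-/
lemma hasDerivAt_trotterStep (w : ℝ) (E : Matrix X X ℂ) (v : Matrix X X ℝ) (N : ℕ) :
    HasDerivAt (trotterStep w E v N) (generator w E v N) 0 := by
  refine hasDerivAt_matrix_of_apply fun y z => ?_
  have h0 (x u : X) : heat w 0 E x u = (1 : Matrix X X ℂ) x u := by simp [heat]
  have h1 : HasDerivAt (fun ε : ℝ => ∏ i, heat w ε E (y i) (z i))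
      (∑ i, (∏ j ∈ Finset.univ.erase i, (1 : Matrix X X ℂ) (y j) (z j)) *
        -((w : ℂ) * E (y i) (z i))) 0 := by
    have := HasDerivAt.fun_finsetProd (u := Finset.univ) (x := (0 : ℝ))
      (f := fun i ε => heat w ε E (y i) (z i)) fun i _ => hasDerivAt_heat w E (y i) (z i)
    simpa only [h0, smul_eq_mul] using this
  have h2 : HasDerivAt (fun ε : ℝ => ((Real.exp (-(ε * interaction v z)) : ℝ) : ℂ))
      (-(interaction v z : ℂ)) 0 := by
    have := (((hasDerivAt_id (0 : ℝ)).mul_const (interaction v z)).neg.exp).ofReal_comp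
    simpa using this
  have h3 := h1.mul h2
  have h4 : ∏ i, heat w 0 E (y i) (z i) = (1 : Matrix (Fin N → X) (Fin N → X) ℂ) y z := by
    rw [← tensorPow_one]
    simp only [h0, tensorPow_apply]
  rw [h4] at h3
  simp only [trotterStep, Matrix.mul_diagonal, tensorPow_apply]
  have h5 : generator w E v N y z = (∑ i, (∏ j ∈ Finset.univ.erase i,
      (1 : Matrix X X ℂ) (y j) (z j)) * -((w : ℂ) * E (y i) (z i))) *
      ((Real.exp (-(0 * interaction v z)) : ℝ) : ℂ) +
      (1 : Matrix (Fin N → X) (Fin N → X) ℂ) y z * -(interaction v z : ℂ) := by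
    simp [generator]
  rw [h5]
  exact h3

/-- Having a site makes the configuration space nonempty, so that the identity has norm one, as the
Chernoff estimate requires. -/
lemma tendsto_trotterStep_pow [Nonempty X] (w : ℝ) (E : Matrix X X ℂ) (v : Matrix X X ℝ) (N : ℕ)
    {β : ℝ} (hβ : 0 < β) :
    Tendsto (fun n : ℕ => trotterStep w E v N (β / n) ^ n) atTop
      (𝓝 (NormedSpace.exp (β • generator w E v N))) :=
  tendsto_pow_of_hasDerivAt (trotterStep_zero w E v N) (hasDerivAt_trotterStep w E v N) hβ

omit [DecidableEq X] in
-- The intertwining relation passes to powers and then, by continuity, to the exponential series.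
lemma exp_intertwine {V ι : Type} [NormedAddCommGroup V] [NormedSpace ℂ V] [FiniteDimensional ℂ V]
    [Fintype ι] [DecidableEq ι] (j : V →ₗ[ℂ] (ι → ℂ)) {A : V →L[ℂ] V} {B : Matrix ι ι ℂ}
    (h : ∀ ψ, j (A ψ) = B *ᵥ j ψ) (ψ : V) :
    j (NormedSpace.exp A ψ) = NormedSpace.exp B *ᵥ j ψ := by
  have : CompleteSpace V := FiniteDimensional.complete ℂ V
  have hpow (k : ℕ) (ψ : V) : j ((A ^ k) ψ) = (B ^ k) *ᵥ j ψ := by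
    induction k generalizing ψ with
    | zero => simp
    | succ k ih => rw [pow_succ, mul_apply_eq_comp, ih, h, pow_succ,
        Matrix.mulVec_mulVec]
  have h1 := ((NormedSpace.exp_series_hasSum_exp' (𝕂 := ℂ) A).mapL
    (ContinuousLinearMap.apply ℂ V ψ)).mapL (LinearMap.toContinuousLinearMap j)
  have h2 := (NormedSpace.exp_series_hasSum_exp' (𝕂 := ℂ) B).map
    (AddMonoidHom.mk' (fun M : Matrix ι ι ℂ => M *ᵥ j ψ) fun M M' => Matrix.add_mulVec M M' _)
    (by
      change Continuous fun M : Matrix ι ι ℂ => M *ᵥ j ψ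
      exact continuous_id.matrix_mulVec continuous_const)
  refine h1.unique ((funext fun k => ?_ : (fun k : ℕ => LinearMap.toContinuousLinearMap j
    (ContinuousLinearMap.apply ℂ V ψ ((k.factorial⁻¹ : ℂ) • A ^ k))) = _) ▸ h2)
  change j ((k.factorial⁻¹ : ℂ) • (A ^ k) ψ) = ((k.factorial⁻¹ : ℂ) • B ^ k) *ᵥ j ψ
  rw [map_smul, hpow, Matrix.smul_mulVec]

/-- Insert symmetrization after inclusion, which is the identity, and move the inclusion around the
trace by cyclicity; the kernel annihilates the complement of the symmetric functions. -/
lemma canonicalZ_eq_trace (w : ℝ) [hw : Fact (0 < w)] (β : ℝ) (E : Matrix X X ℂ)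
    (v : Matrix X X ℝ) (N : ℕ) (F : BosonSpace X w N →ₗ[ℂ] BosonSpace X w N) :
    canonicalZ w β E v N F
      = (bosonKernel (1 + F) * NormedSpace.exp (β • generator w E v N)).trace := by
  set A : BosonSpace X w N →L[ℂ] BosonSpace X w N :=
    LinearMap.toContinuousLinearMap (-(β : ℂ) • hamiltonian w E v N) with hA
  set B := β • generator w E v N with hB
  have h1 (ψ : BosonSpace X w N) : symmIncl X w N (A ψ) = B *ᵥ symmIncl X w N ψ := by
    have : A ψ = -(β : ℂ) • hamiltonian w E v N ψ := rfl
    rw [this, map_smul, symmIncl_hamiltonian hw.out.ne', neg_smul, smul_neg, neg_neg, hB,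
      Matrix.smul_mulVec]
    rfl
  have h2 : symmIncl X w N ∘ₗ (NormedSpace.exp A).toLinearMap
      = Matrix.toLin' (NormedSpace.exp B) ∘ₗ symmIncl X w N :=
    LinearMap.ext fun ψ => exp_intertwine (symmIncl X w N) h1 ψ
  have h3 : Matrix.toLin' (bosonKernel (1 + F))
      = symmIncl X w N ∘ₗ (1 + F) ∘ₗ symmetrize X w N := Matrix.toLin'_toMatrix' _
  calc canonicalZ w β E v N F
      = LinearMap.trace ℂ (BosonSpace X w N)
        (((NormedSpace.exp A).toLinearMap ∘ₗ (1 + F) ∘ₗ symmetrize X w N) ∘ₗ symmIncl X w N) := by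
        rw [LinearMap.comp_assoc, LinearMap.comp_assoc, symmetrize_comp_symmIncl,
          LinearMap.comp_id]
        rfl
    _ = LinearMap.trace ℂ ((Fin N → X) → ℂ)
        (Matrix.toLin' (NormedSpace.exp B) ∘ₗ Matrix.toLin' (bosonKernel (1 + F))) := by
        rw [LinearMap.trace_comp_comm', h3, ← LinearMap.comp_assoc, h2, LinearMap.comp_assoc]
    _ = _ := by
        rw [← Matrix.toLin'_mul, Matrix.trace_toLin'_eq, Matrix.trace_mul_comm]

end Hamiltonian

end LatticeBosons

open LatticeBosons in
theorem mainTheorem2 (d M : ℕ) [NeZero M] (η : ℝ) [Fact (0 < η)]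
    (E : Matrix (Torus d M) (Torus d M) ℂ) (hE : E.PosDef)
    (v : Matrix (Torus d M) (Torus d M) ℝ) (hv : v.PosSemidef)
    (β : ℝ) (hβ : 0 < β) (N : ℕ) :
    -- the time-sliced integrals converge to the canonical generating function
    (∀ F : BosonSpace (Torus d M) (η ^ d) N →ₗ[ℂ] BosonSpace (Torus d M) (η ^ d) N,
      Tendsto (fun n : ℕ => canonicalZSliced (η ^ d) β E v N F n) atTop
        (𝓝 (canonicalZ (η ^ d) β E v N F))) ∧
    -- the integrals over `a` and then over `h` converge absolutely
    (∀ n : ℕ, 1 ≤ n →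
      ∀ F : BosonSpace (Torus d M) (η ^ d) N →ₗ[ℂ] BosonSpace (Torus d M) (η ^ d) N,
        (∀ h : Fin (n + 1) → Torus d M → ℝ,
          Integrable (fun a => integrand (η ^ d) β E N F n h a)
            (fieldMeasure (Torus d M) (η ^ d) n)) ∧
        Integrable (fun h => ∫ a, integrand (η ^ d) β E N F n h a
          ∂(fieldMeasure (Torus d M) (η ^ d) n)) (auxMeasure v n)) ∧
    -- `Q(h)` has positive Hermitian part for real `h`
    (∀ n : ℕ, 1 ≤ n → ∀ h : Fin (n + 1) → Torus d M → ℝ,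
      ((1 / 2 : ℂ) • (Qop (η ^ d) β E n (toComplex h) +
        (Qop (η ^ d) β E n (toComplex h))ᴴ)).PosDef) ∧
    -- the matrix element for `F = 0`
    (∀ b a : Torus d M → ℂ, matrixElement (η ^ d) N 0 b a =
      1 / (N.factorial : ℂ) * bili (η ^ d) (fun x => conj (b x)) a ^ N) ∧
    -- `C(h) = Q(h)⁻¹` exists and is entire analytic in `h`
    (∀ n : ℕ, 1 ≤ n →
      (∀ h : Fin (n + 1) → Torus d M → ℂ, IsUnit (Qop (η ^ d) β E n h)) ∧
      ∀ p q : Fin (n + 1) × Torus d M,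
        AnalyticOnNhd ℂ (fun h : Fin (n + 1) → Torus d M → ℂ => Cov (η ^ d) β E n h p q)
          Set.univ) ∧
    -- the uniform bound
    (GeneratesStochasticProcess (η ^ d) E →
      ∀ n : ℕ, 1 ≤ n → ∀ h : Fin (n + 1) → Torus d M → ℝ, ∀ p q : Fin (n + 1) × Torus d M,
        ((‖Cov (η ^ d) β E n (toComplex h) p q‖ : ℝ) : ℂ) ≤ Cov (η ^ d) β E n 0 p q) := by
  refine ⟨fun F => ?_, fun n hn F => ⟨fun h => integrable_integrand hE hβ F hn h,
    (integrable_and_integral_aux hE hv hβ F hn).1⟩,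
    fun n hn h => posDef_hermitianPart_Qop hE (pow_pos Fact.out d) hβ hn h,
    fun b a => matrixElement_zero _ N b a,
    fun n _ => ⟨fun h => isUnit_Qop _ β E n h, fun p q => analyticOnNhd_Cov _ β E n p q⟩,
    fun hS n _ h p q => norm_Cov_le hβ hS h p q⟩
  rw [canonicalZ_eq_trace]
  have hcont : Continuous fun M : Matrix (Fin N → Torus d M) (Fin N → Torus d M) ℂ =>
      (bosonKernel (1 + F) * M).trace :=
    (continuous_const.matrix_mul continuous_id).matrix_trace
  -- The trace formula is available only for `n ≥ 1`, hence an eventual equality.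
  refine ((hcont.tendsto _).comp (tendsto_trotterStep_pow (η ^ d) E v N hβ)).congr' ?_
  filter_upwards [eventually_ge_atTop 1] with n hn
  exact (integrable_and_integral_aux hE hv hβ F hn).2.symm
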